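/- Let $\mathbb H$ be the upper half plane. Let $N=(n_{ij})\in GL(2,\mathbb Z)$ have eigenvalues $\alpha>1$ and $-1/\alpha$, let $\boldsymbol a={}^T(a_1,a_2)$, $\boldsymbol b={}^T(b_1,b_2)\in\mathbb R^2$ be eigenvectors of $N$ for $\alpha$ and $-1/\alpha$ respectively, and let $p,q,r\in\mathbb Z$ with $r\neq 0$. Put $\theta=\det(\boldsymbol a,\boldsymbol b)=a_1b_2-a_2b_1$ and $$e_i=\tfrac12 n_{i1}(n_{i1}-1)a_1b_1+\tfrac12 n_{i2}(n_{i2}-1)a_2b_2+n_{i1}n_{i2}b_1a_2\qquad(i=1,2),$$ and let $(c_1,c_2)\in\mathbb R^2$ be the solution of $$(N+I)\begin{pmatrix}c_1\\c_2\end{pmatrix}+\begin{pmatrix}e_1\\e_2\end{pmatrix}-\frac{\theta}{r}\begin{pmatrix}p\\q\end{pmatrix}=0 .$$ Let $G^-_{N,p,q,r}$ be the group of automorphisms of $\mathbb H\times\mathbb C$ generated by $$g_0:(w,z)\mapsto(\alpha w,-z),\qquad g_i:(w,z)\mapsto(w+a_i,\;z+b_iw+c_i)\ (i=1,2),\qquad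 g_3:(w,z)\mapsto\Bigl(w,\;z-\frac{\theta}{r}\Bigr).$$ It acts freely and properly discontinuously; the complex surface $S^-_{N,p,q,r,\boldsymbol a,\boldsymbol b}=(\mathbb H\times\mathbb C)/G^-_{N,p,q,r}$ is called an Inoue surface of type $S^-$. Two complex manifolds $S_1,S_2$ are deformation equivalent if there are connected complex manifolds $\mathcal X$ and $B$, a proper holomorphic submersion $\pi:\mathcal X\to B$ and points $t_1,t_2\in B$ such that $\pi^{-1}(t_i)$ is biholomorphic to $S_i$ for $i=1,2$. (Deformation equivalence classes are the classes of the equivalence relation generated by this relation.) **Proposition.** For every Inoue surface $S^-_{N,p,q,r,\boldsymbol a,\boldsymbol b}$ of type $S^-$, the number of deformation equivalence classes of Inoue surfaces of type $S^-$ that are homotopy equivalent to $S^-_{N,p,q,r,\boldsymbol a,\boldsymbol b}$ is less than or equal to $8$. More precisely, these surfaces can be divided into at most $8$ families such that any two surfaces in the same family are deformation equivalent in the above sense (the two surfaces are themselves fibres of one and the same $\pi$). -/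

import Mathlib

open scoped Manifold ContDiff

/-! ### Complex manifolds and deformation equivalence -/

/-- A complex manifold: a Hausdorff, second countable space with a holomorphic atlas modelled on a
finite-dimensional complex vector space. -/
structure ComplexManifold where
  carrier : Type
  model : Type
  [normedAddCommGroup : NormedAddCommGroup model]
  [normedSpace : NormedSpace ℂ model]
  [finiteDimensional : FiniteDimensional ℂ model]
  [topologicalSpace : TopologicalSpace carrier]
  [t2Space : T2Space carrier]
  [secondCountable : SecondCountableTopology carrier]
  [chartedSpace : ChartedSpace model carrier]
  [isManifold : IsManifold 𝓘(ℂ, model) ω carrier]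

namespace ComplexManifold

instance : CoeSort ComplexManifold Type := ⟨carrier⟩

attribute [instance] normedAddCommGroup normedSpace finiteDimensional topologicalSpace t2Space
  secondCountable chartedSpace isManifold

/-- Holomorphic maps between complex manifolds. -/
def Holomorphic {X Y : ComplexManifold} (f : X → Y) : Prop :=
  ContMDiff 𝓘(ℂ, X.model) 𝓘(ℂ, Y.model) ω f

/-- A smooth (i.e. submersive) proper holomorphic map. -/
structure IsSmoothProper {X B : ComplexManifold} (π : X → B) : Prop where
  holomorphic : Holomorphic π
  surjective_mfderiv : ∀ x, Function.Surjective (mfderiv 𝓘(ℂ, X.model) 𝓘(ℂ, B.model) π x)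
  proper : IsProperMap π

/-- `S` is biholomorphic to the complex submanifold `π⁻¹(t)` of `X`: there is a holomorphic
embedding of `S` into `X` whose image is `π⁻¹(t)`. -/
def BiholomorphicToFiber (S : ComplexManifold) {X B : ComplexManifold} (π : X → B) (t : B) :
    Prop :=
  ∃ ι : S → X, Holomorphic ι ∧
    (∀ s, Function.Injective (mfderiv 𝓘(ℂ, S.model) 𝓘(ℂ, X.model) ι s)) ∧
    Topology.IsEmbedding ι ∧ Set.range ι = π ⁻¹' {t}

/-- `S₁` and `S₂` occur, up to biholomorphism, as two fibres of a smooth proper holomorphic map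
between connected complex manifolds. -/
def DeformationEquivalent (S₁ S₂ : ComplexManifold) : Prop :=
  ∃ (X B : ComplexManifold) (π : X → B) (t₁ t₂ : B),
    ConnectedSpace X ∧ ConnectedSpace B ∧ IsSmoothProper π ∧
    BiholomorphicToFiber S₁ π t₁ ∧ BiholomorphicToFiber S₂ π t₂

/-- Homotopy equivalence of the underlying topological spaces. -/
def HomotopyEquivalent (S₁ S₂ : ComplexManifold) : Prop :=
  Nonempty (ContinuousMap.HomotopyEquiv S₁ S₂)

end ComplexManifold

/-- The quotient of a complex manifold by a free, properly discontinuous group of biholomorphic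
maps is a complex manifold. -/
theorem isManifold_orbitQuotient {M G : Type*} [TopologicalSpace M] [Group G] [MulAction G M]
    [ProperlyDiscontinuousSMul G M] [ContinuousConstSMul G M] [IsCancelSMul G M]
    [T2Space M] [LocallyCompactSpace M] {E : Type*} [NormedAddCommGroup E] [NormedSpace ℂ E]
    {H : Type*} [TopologicalSpace H] (I : ModelWithCorners ℂ E H) [ChartedSpace H M]
    [IsManifold I ω M] (hG : ∀ g : G, ContMDiff I I ω fun x : M => g • x) :
    IsManifold I ω (MulAction.orbitRel.Quotient G M) := by
  have hloc : IsLocalHomeomorph (Quotient.mk (MulAction.orbitRel G M)) :=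
    isQuotientCoveringMap_quotientMk_of_properlyDiscontinuousSMul.isCoveringMap.isLocalHomeomorph
  apply isManifold_of_contDiffOn
  intro e e' he he'
  obtain ⟨x₀, rfl⟩ : ∃ x₀, e = (hloc.localInverseAt x₀).trans (chartAt H x₀) := by
    obtain ⟨q, rfl⟩ := he
    exact ⟨_, rfl⟩
  obtain ⟨x₀', rfl⟩ : ∃ x₀, e' = (hloc.localInverseAt x₀).trans (chartAt H x₀) := by
    obtain ⟨q, rfl⟩ := he'
    exact ⟨_, rfl⟩
  clear he he'
  rintro u ⟨hu, y, rfl⟩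
  simp only [OpenPartialHomeomorph.trans_source, OpenPartialHomeomorph.trans_symm_eq_symm_trans_symm,
    Set.mem_preimage, Set.mem_inter_iff, OpenPartialHomeomorph.coe_trans,
    OpenPartialHomeomorph.symm_source, Function.comp_apply, I.left_inv,
    IsLocalHomeomorph.localInverseAt_symm] at hu
  obtain ⟨⟨hy, hy1⟩, hy2, hy3⟩ := hu
  set x₁ := (chartAt H x₀).symm y with hx₁
  obtain ⟨g, hg⟩ : ∃ g : G, g • x₁ = hloc.localInverseAt x₀' (Quotient.mk _ x₁) := by
    have := hloc.apply_localInverseAt_of_mem hy2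
    exact Quotient.exact this
  have hx₁s : x₁ ∈ (chartAt H x₀).source := (chartAt H x₀).map_target hy
  have key := (contMDiffAt_iff_of_mem_source (x := x₀) (y := x₀') hx₁s
    (by rw [hg]; exact hy3)).mp (hG g x₁)
  have hxy : extChartAt I x₀ x₁ = I y := by
    simp [extChartAt, hx₁, (chartAt H x₀).right_inv hy]
  rw [hxy] at key
  have hW : {x : M | Quotient.mk (MulAction.orbitRel G M) x ∈ (hloc.localInverseAt x₀').source ∧
      g • x ∈ (hloc.localInverseAt x₀').target} ∈ nhds x₁ := by
    refine Filter.inter_mem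
      (hloc.continuous.continuousAt ((hloc.localInverseAt x₀').open_source.mem_nhds hy2))
      ((continuous_const_smul g).continuousAt
        ((hloc.localInverseAt x₀').open_target.mem_nhds ?_))
    rw [hg]
    exact (hloc.localInverseAt x₀').map_source hy2
  have hcont : ContinuousAt (extChartAt I x₀).symm (I y) := by
    rw [← hxy]
    exact continuousAt_extChartAt_symm' (by rwa [extChartAt_source])
  have hsymm : (extChartAt I x₀).symm (I y) = x₁ := by simp [extChartAt, hx₁]
  have hev := hcont (hsymm.symm ▸ hW)
  have hEq : ∀ v, v ∈ (extChartAt I x₀).symm ⁻¹' {x : M |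
      Quotient.mk (MulAction.orbitRel G M) x ∈ (hloc.localInverseAt x₀').source ∧
      g • x ∈ (hloc.localInverseAt x₀').target} →
      (I ∘ (((hloc.localInverseAt x₀).trans (chartAt H x₀)).symm.trans
        ((hloc.localInverseAt x₀').trans (chartAt H x₀'))) ∘ I.symm) v =
      (extChartAt I x₀' ∘ (fun x => g • x) ∘ (extChartAt I x₀).symm) v := by
    rintro v ⟨hv1, hv2⟩
    have : hloc.localInverseAt x₀' (Quotient.mk _ ((extChartAt I x₀).symm v)) =
        g • (extChartAt I x₀).symm v := by
      apply hloc.injOn_localInverseAt_target ((hloc.localInverseAt x₀').map_source hv1) hv2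
      rw [hloc.apply_localInverseAt_of_mem hv1]
      exact Quotient.sound ⟨g⁻¹, by simp⟩
    simp only [Function.comp_apply]
    rw [← this]
    simp [extChartAt]
  refine (key.2.mono Set.inter_subset_right).congr_of_eventuallyEq ?_ (hEq _ ?_)
  · exact Filter.mem_of_superset (mem_nhdsWithin_of_mem_nhds hev) hEq
  · exact mem_of_mem_nhds hev

/-! ### Inoue surfaces of type `S⁻` -/

/-- The parameters of an Inoue surface of type `S⁻`: a matrix `N ∈ GL(2, ℤ)` with eigenvalues
`α > 1` and `-1/α`, real eigenvectors `a`, `b` for `α`, `-1/α`, and integers `p`, `q`, `r ≠ 0`. -/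
structure InoueSMinusData where
  N : Matrix.GeneralLinearGroup (Fin 2) ℤ
  p : ℤ
  q : ℤ
  r : ℤ
  a : Fin 2 → ℝ
  b : Fin 2 → ℝ
  α : ℝ
  r_ne_zero : r ≠ 0
  one_lt_α : 1 < α
  a_ne_zero : a ≠ 0
  b_ne_zero : b ≠ 0
  mulVec_a : (N.val.map (Int.cast : ℤ → ℝ)).mulVec a = α • a
  mulVec_b : (N.val.map (Int.cast : ℤ → ℝ)).mulVec b = (-1 / α) • b

/-- The automorphism `(w, z) ↦ (s w + A, ε z + B w + C)` of `ℍ × ℂ`, for real numbers `s > 0`,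
`A`, `B`, `C` and `ε ≠ 0`. -/
noncomputable def affineAut (s : {x : ℝ // 0 < x}) (A : ℝ) (ε : ℝˣ) (B C : ℝ) :
    (UpperHalfPlane × ℂ) ≃ₜ (UpperHalfPlane × ℂ) where
  toFun x := (A +ᵥ s • x.1, (ε : ℝ) * x.2 + B * (x.1 : ℂ) + C)
  invFun y := (s⁻¹ • (-A +ᵥ y.1),
    ((ε⁻¹ : ℝˣ) : ℝ) * (y.2 - B * ((s⁻¹ • (-A +ᵥ y.1) : UpperHalfPlane) : ℂ) - C))
  left_inv x := by
    have h : ((ε : ℝ) : ℂ) ≠ 0 := by exact_mod_cast ε.ne_zero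
    ext
    · simp
    · simp; field_simp; ring
  right_inv y := by
    have h : ((ε : ℝ) : ℂ) ≠ 0 := by exact_mod_cast ε.ne_zero
    ext
    · simp
    · simp; field_simp; ring
  continuous_toFun := by
    have h : Continuous fun x : UpperHalfPlane × ℂ => A +ᵥ s • x.1 := by
      rw [UpperHalfPlane.isEmbedding_coe.continuous_iff]
      have := UpperHalfPlane.continuous_coe
      simp only [Function.comp_def, UpperHalfPlane.coe_vadd, UpperHalfPlane.coe_pos_real_smul]
      fun_prop
    have := UpperHalfPlane.continuous_coe
    fun_prop
  continuous_invFun := by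
    have h : Continuous fun x : UpperHalfPlane × ℂ => s⁻¹ • (-A +ᵥ x.1) := by
      rw [UpperHalfPlane.isEmbedding_coe.continuous_iff]
      have := UpperHalfPlane.continuous_coe
      simp only [Function.comp_def, UpperHalfPlane.coe_vadd, UpperHalfPlane.coe_pos_real_smul]
      fun_prop
    have := UpperHalfPlane.continuous_coe
    fun_prop

theorem affineAut_snd_re (s : {x : ℝ // 0 < x}) (A : ℝ) (ε : ℝˣ) (B C : ℝ)
    (x : UpperHalfPlane × ℂ) : (affineAut s A ε B C x).2.re = ε * x.2.re + B * x.1.re + C := by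
  simp [affineAut]

theorem affineAut_snd_im (s : {x : ℝ // 0 < x}) (A : ℝ) (ε : ℝˣ) (B C : ℝ)
    (x : UpperHalfPlane × ℂ) : (affineAut s A ε B C x).2.im = ε * x.2.im + B * x.1.im := by
  simp [affineAut]

theorem affineAut_mul (s s' : {x : ℝ // 0 < x}) (A A' : ℝ) (ε ε' : ℝˣ) (B B' C C' : ℝ) :
    affineAut s A ε B C * affineAut s' A' ε' B' C' =
      affineAut (s * s') (s * A' + A) (ε * ε') (ε * B' + B * s') (ε * C' + B * A' + C) := by
  ext x
  · simp [affineAut]; ring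
  · simp [affineAut]; ring

theorem affineAut_congr {s s' : {x : ℝ // 0 < x}} {A A' : ℝ} {ε ε' : ℝˣ} {B B' C C' : ℝ}
    (hs : (s : ℝ) = s') (hA : A = A') (hε : ε = ε') (hB : B = B') (hC : C = C') :
    affineAut s A ε B C = affineAut s' A' ε' B' C' := by
  rw [Subtype.ext hs, hA, hε, hB, hC]

theorem contMDiff_affineAut (s : {x : ℝ // 0 < x}) (A : ℝ) (ε : ℝˣ) (B C : ℝ) :
    ContMDiff (𝓘(ℂ).prod 𝓘(ℂ)) (𝓘(ℂ).prod 𝓘(ℂ)) ω (affineAut s A ε B C) := by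
  have h1 : ContMDiff (𝓘(ℂ).prod 𝓘(ℂ)) 𝓘(ℂ) ω
      fun x : UpperHalfPlane × ℂ => (x.1 : ℂ) :=
    UpperHalfPlane.contMDiff_coe.comp contMDiff_fst
  have h2 : ContMDiff (𝓘(ℂ).prod 𝓘(ℂ)) 𝓘(ℂ) ω fun x : UpperHalfPlane × ℂ => x.2 :=
    contMDiff_snd
  refine ContMDiff.prodMk ?_ ?_
  · have h3 : ContMDiff (𝓘(ℂ).prod 𝓘(ℂ)) 𝓘(ℂ) ω
        fun x : UpperHalfPlane × ℂ => ((A +ᵥ s • x.1 : UpperHalfPlane) : ℂ) := by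
      have : ContDiff ℂ ω fun w : ℂ => (A : ℂ) + ((s : ℝ) : ℂ) * w := by fun_prop
      simpa [Function.comp_def] using this.contMDiff.comp h1
    intro x
    have h4 := (UpperHalfPlane.contMDiffAt_ofComplex (n := ω)
      (A +ᵥ s • x.1 : UpperHalfPlane).im_pos).comp x (h3 x)
    exact h4.congr_of_eventuallyEq (.of_forall fun y => (UpperHalfPlane.ofComplex_apply _).symm)
  · have : ContDiff ℂ ω fun v : ℂ × ℂ => ((ε : ℝ) : ℂ) * v.2 + B * v.1 + C := by fun_prop
    exact this.contMDiff.comp (h1.prodMk_space h2)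

namespace InoueSMinusData

variable (D : InoueSMinusData)

/-- `θ = det (a, b)`. -/
def θ : ℝ := D.a 0 * D.b 1 - D.a 1 * D.b 0

/-- `e_i = n_{i1} (n_{i1} - 1) a₁ b₁ / 2 + n_{i2} (n_{i2} - 1) a₂ b₂ / 2 + n_{i1} n_{i2} b₁ a₂`. -/
noncomputable def e (i : Fin 2) : ℝ :=
  (1 / 2) * D.N.val i 0 * (D.N.val i 0 - 1) * D.a 0 * D.b 0 +
  (1 / 2) * D.N.val i 1 * (D.N.val i 1 - 1) * D.a 1 * D.b 1 +
  D.N.val i 0 * D.N.val i 1 * D.b 0 * D.a 1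

/-- The solution `c` of `(N + I) c + e - (θ / r) (p, q)ᵀ = 0`. -/
noncomputable def c : Fin 2 → ℝ :=
  (D.N.val.map (Int.cast : ℤ → ℝ) + 1)⁻¹.mulVec ((D.θ / D.r) • ![(D.p : ℝ), D.q] - D.e)

/-- `g₀ : (w, z) ↦ (α w, -z)`. -/
noncomputable def g₀ : (UpperHalfPlane × ℂ) ≃ₜ (UpperHalfPlane × ℂ) :=
  affineAut ⟨D.α, one_pos.trans D.one_lt_α⟩ 0 (-1) 0 0

/-- `g₁`, `g₂` are `(w, z) ↦ (w + a_i, z + b_i w + c_i)`. -/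
noncomputable def g (i : Fin 2) : (UpperHalfPlane × ℂ) ≃ₜ (UpperHalfPlane × ℂ) :=
  affineAut ⟨1, one_pos⟩ (D.a i) 1 (D.b i) (D.c i)

/-- `g₃ : (w, z) ↦ (w, z - θ / r)`. -/
noncomputable def g₃ : (UpperHalfPlane × ℂ) ≃ₜ (UpperHalfPlane × ℂ) :=
  affineAut ⟨1, one_pos⟩ 0 1 0 (-(D.θ / D.r))

/-- The group `G` of automorphisms of `ℍ × ℂ` generated by `g₀, g₁, g₂, g₃`. -/
noncomputable def group : Subgroup ((UpperHalfPlane × ℂ) ≃ₜ (UpperHalfPlane × ℂ)) :=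
  Subgroup.closure {D.g₀, D.g 0, D.g 1, D.g₃}

noncomputable instance : MulAction D.group (UpperHalfPlane × ℂ) where
  smul g x := g.1 x
  one_smul _ := rfl
  mul_smul _ _ _ := rfl

theorem smul_def (g : D.group) (x : UpperHalfPlane × ℂ) : g • x = g.1 x := rfl

instance : ContinuousConstSMul D.group (UpperHalfPlane × ℂ) where
  continuous_const_smul g := g.1.continuous

/-! ### The action is free and properly discontinuous -/

theorem eq_a (i : Fin 2) : D.N.val i 0 * D.a 0 + D.N.val i 1 * D.a 1 = D.α * D.a i := by
  simpa [Matrix.mulVec, dotProduct, Fin.sum_univ_two] using congrFun D.mulVec_a i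

theorem eq_b (i : Fin 2) : D.N.val i 0 * D.b 0 + D.N.val i 1 * D.b 1 = (-1 / D.α) * D.b i := by
  simpa [Matrix.mulVec, dotProduct, Fin.sum_univ_two] using congrFun D.mulVec_b i

theorem α_pos : 0 < D.α := one_pos.trans D.one_lt_α

theorem θ_ne_zero : D.θ ≠ 0 := by
  intro h
  unfold θ at h
  have hα := D.α_pos
  have ha := D.eq_a
  have hb := D.eq_b
  have key : ∀ i j, D.a i * D.b j = 0 := by
    have h0 : D.a 0 * D.b 1 = D.a 1 * D.b 0 := by linarith
    have hne : D.α + 1 / D.α ≠ 0 := by positivity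
    have h1 : ∀ i j, D.a i * D.b j = D.a j * D.b i := by
      intro i j; fin_cases i <;> fin_cases j <;> simp <;> linarith
    have h2 : ∀ i j, D.α * D.a i * D.b j = (-1 / D.α) * D.b i * D.a j := by
      intro i j
      rw [← ha, ← hb]
      linear_combination (D.N.val i 0 : ℝ) * h1 0 j + (D.N.val i 1 : ℝ) * h1 1 j
    intro i j
    have : (D.α + 1 / D.α) * (D.a i * D.b j) = 0 := by
      linear_combination h2 i j + (-1 / D.α) * h1 j i
    exact (mul_eq_zero.mp this).resolve_left hne
  obtain ⟨i, hi⟩ := Function.ne_iff.mp D.a_ne_zero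
  obtain ⟨j, hj⟩ := Function.ne_iff.mp D.b_ne_zero
  exact (mul_ne_zero hi hj) (key i j)

theorem det_eq : D.N.val 0 0 * D.N.val 1 1 - D.N.val 0 1 * D.N.val 1 0 = -1 := by
  have hα := D.α_pos
  have ha := D.eq_a
  have hb := D.eq_b
  have : ((D.N.val 0 0 : ℝ) * D.N.val 1 1 - D.N.val 0 1 * D.N.val 1 0) * D.θ = -1 * D.θ := by
    have h2 : (D.α * D.a 0) * ((-1 / D.α) * D.b 1) - (D.α * D.a 1) * ((-1 / D.α) * D.b 0)
      = -1 * D.θ := by unfold θ; field_simp; ring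
    rw [← h2, ← ha, ← ha, ← hb, ← hb]; unfold θ; ring
  exact_mod_cast mul_right_cancel₀ D.θ_ne_zero this

theorem eq_c (i : Fin 2) : D.N.val i 0 * D.c 0 + D.N.val i 1 * D.c 1 + D.c i + D.e i
    - D.θ / D.r * (![(D.p : ℝ), D.q] i) = 0 := by
  have hα := D.α_pos
  have ha := D.eq_a
  have hb := D.eq_b
  set M := D.N.val.map (Int.cast : ℤ → ℝ) + 1 with hM
  have hdet : M.det * D.θ = (D.α + 1) * (-1 / D.α + 1) * D.θ := by
    have h2 : (D.α * D.a 0 + D.a 0) * ((-1 / D.α) * D.b 1 + D.b 1)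
        - (D.α * D.a 1 + D.a 1) * ((-1 / D.α) * D.b 0 + D.b 0)
      = (D.α + 1) * (-1 / D.α + 1) * D.θ := by unfold θ; ring
    rw [← h2, ← ha, ← ha, ← hb, ← hb, Matrix.det_fin_two]; unfold θ; simp [hM]; ring
  have hu : IsUnit M.det := by
    rw [mul_right_cancel₀ D.θ_ne_zero hdet, isUnit_iff_ne_zero]
    refine mul_ne_zero (by positivity) ?_
    have := D.one_lt_α
    have h3 : -1 / D.α + 1 = (D.α - 1) / D.α := by field_simp; ring
    rw [h3]
    exact div_ne_zero (by linarith) hα.ne'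
  have h : M.mulVec D.c = (D.θ / D.r) • ![(D.p : ℝ), D.q] - D.e := by
    unfold c
    rw [Matrix.mulVec_mulVec, ← hM, Matrix.mul_nonsing_inv _ hu, Matrix.one_mulVec]
  have := congrFun h i
  fin_cases i <;>
  · simp [hM, Matrix.mulVec, dotProduct, Fin.sum_univ_two] at this ⊢
    linarith

/-- The constant term of `g₁ ^ m₀ * g₂ ^ m₁ * g₃ ^ k`. -/
noncomputable def const (m₀ m₁ k : ℤ) : ℝ :=
  m₀ * D.c 0 + m₁ * D.c 1 + (1 / 2) * m₀ * (m₀ - 1) * D.a 0 * D.b 0 +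
    (1 / 2) * m₁ * (m₁ - 1) * D.a 1 * D.b 1 + m₀ * m₁ * D.b 0 * D.a 1 - k * (D.θ / D.r)

/-- The element `g₁ ^ m₀ * g₂ ^ m₁ * g₃ ^ k * g₀ ^ n`. -/
noncomputable def normalForm (n m₀ m₁ k : ℤ) :
    (UpperHalfPlane × ℂ) ≃ₜ (UpperHalfPlane × ℂ) :=
  affineAut ⟨D.α ^ n, zpow_pos D.α_pos n⟩ (m₀ * D.a 0 + m₁ * D.a 1) ((-1) ^ n)
    ((m₀ * D.b 0 + m₁ * D.b 1) * D.α ^ n) (D.const m₀ m₁ k)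

theorem r_ne : (D.r : ℝ) ≠ 0 := by exact_mod_cast D.r_ne_zero

theorem g₃_mul (n m₀ m₁ k : ℤ) : D.g₃ * D.normalForm n m₀ m₁ k = D.normalForm n m₀ m₁ (k + 1) := by
  simp only [g₃, normalForm, affineAut_mul]
  apply affineAut_congr <;> simp [const]
  ring

theorem g_zero_mul (n m₀ m₁ k : ℤ) :
    D.g 0 * D.normalForm n m₀ m₁ k = D.normalForm n (m₀ + 1) m₁ k := by
  simp only [g, normalForm, affineAut_mul]
  apply affineAut_congr <;> simp [const] <;> ring

theorem g_one_mul (n m₀ m₁ k : ℤ) :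
    D.g 1 * D.normalForm n m₀ m₁ k = D.normalForm n m₀ (m₁ + 1) (k - D.r * m₀) := by
  have := D.r_ne
  simp only [g, normalForm, affineAut_mul]
  apply affineAut_congr <;> simp [const, θ] <;> field_simp <;> ring

theorem exists_g₀_mul (m₀ m₁ : ℤ) : ∃ l : ℤ, ∀ n k, D.g₀ * D.normalForm n m₀ m₁ k =
    D.normalForm (n + 1) (m₀ * D.N.val 0 0 + m₁ * D.N.val 1 0)
      (m₀ * D.N.val 0 1 + m₁ * D.N.val 1 1) (l - k) := by
  obtain ⟨s, hs⟩ := Int.even_mul_pred_self m₀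
  obtain ⟨t, ht⟩ := Int.even_mul_pred_self m₁
  have hr := D.r_ne
  have hα := D.α_pos.ne'
  have a0 := D.eq_a 0
  have a1 := D.eq_a 1
  have b0 := D.eq_b 0
  have b1 := D.eq_b 1
  have c0 := D.eq_c 0
  have c1 := D.eq_c 1
  have hd : (D.N.val 0 0 * D.N.val 1 1 - D.N.val 0 1 * D.N.val 1 0 : ℝ) = -1 := by
    exact_mod_cast D.det_eq
  have hs' : (m₀ * (m₀ - 1) : ℝ) = s + s := by exact_mod_cast hs
  have ht' : (m₁ * (m₁ - 1) : ℝ) = t + t := by exact_mod_cast ht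
  refine ⟨m₀ * D.p + m₁ * D.q - D.r * (s * D.N.val 0 0 * D.N.val 0 1 +
    t * D.N.val 1 0 * D.N.val 1 1 + m₀ * m₁ * D.N.val 0 1 * D.N.val 1 0), fun n k => ?_⟩
  simp only [g₀, normalForm, affineAut_mul]
  apply affineAut_congr
  · simp [zpow_add₀ hα]; ring
  · simp; linear_combination (-m₀ : ℝ) * a0 - m₁ * a1
  · rw [zpow_add, mul_comm]; simp
  · simp [zpow_add₀ hα]
    have : ∀ x y z : ℝ, x = -1 / D.α * y → -(y * z) = x * (z * D.α) := by
      intro x y z h; rw [h]; field_simp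
    apply this
    linear_combination (m₀ : ℝ) * b0 + m₁ * b1
  · have R : ∀ x y x' y' z w z' w' : ℝ, x = D.α * x' → y = -1 / D.α * y' → z = D.α * z' →
        w = -1 / D.α * w' → x * w + z * y = -(x' * w' + z' * y') := by
      intro x y x' y' z w z' w' h h' h'' h'''; rw [h, h', h'', h''']; field_simp; ring
    have R0 := R _ _ _ _ _ _ _ _ a0 b0 a0 b0
    have R1 := R _ _ _ _ _ _ _ _ a1 b1 a1 b1
    have P := R _ _ _ _ _ _ _ _ a0 b0 a1 b1
    have hτ : D.θ / D.r * D.r = D.a 0 * D.b 1 - D.a 1 * D.b 0 := by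
      rw [← θ]; field_simp
    simp [e] at c0 c1
    simp [const]
    generalize D.θ / D.r = τ at *
    linear_combination (-m₀ : ℝ) * c0 - m₁ * c1 + (1 / 2 * m₀ - 1 / 2 * m₀ ^ 2) / 2 * R0 +
      (1 / 2 * m₁ - 1 / 2 * m₁ ^ 2) / 2 * R1 - (1 / 2) * m₀ * m₁ * P +
      (1 / 2) * (D.a 0 * D.b 1 - D.a 1 * D.b 0) * m₀ * m₁ * hd +
      (1 / 2) * (D.a 0 * D.b 1 - D.a 1 * D.b 0) * D.N.val 0 0 * D.N.val 0 1 * hs' +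
      (1 / 2) * (D.a 0 * D.b 1 - D.a 1 * D.b 0) * D.N.val 1 0 * D.N.val 1 1 * ht' -
      (s * D.N.val 0 0 * D.N.val 0 1 +
        t * D.N.val 1 0 * D.N.val 1 1 + m₀ * m₁ * D.N.val 0 1 * D.N.val 1 0) * hτ

theorem exists_normalForm {x} (hx : x ∈ D.group) :
    ∃ n m₀ m₁ k, x = D.normalForm n m₀ m₁ k := by
  induction hx using Subgroup.closure_induction_left with
  | one =>
    refine ⟨0, 0, 0, 0, ?_⟩
    ext x <;> simp [normalForm, affineAut, const]
  | mul_left x hx y hy ih =>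
    obtain ⟨n, m₀, m₁, k, rfl⟩ := ih
    obtain rfl | rfl | rfl | rfl := hx
    · obtain ⟨l, hl⟩ := D.exists_g₀_mul m₀ m₁
      exact ⟨_, _, _, _, hl n k⟩
    · exact ⟨_, _, _, _, D.g_zero_mul _ _ _ _⟩
    · exact ⟨_, _, _, _, D.g_one_mul _ _ _ _⟩
    · exact ⟨_, _, _, _, D.g₃_mul _ _ _ _⟩
  | inv_mul_cancel x hx y hy ih =>
    obtain ⟨n, m₀, m₁, k, rfl⟩ := ih
    simp only [inv_mul_eq_iff_eq_mul]
    obtain rfl | rfl | rfl | rfl := hx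
    · obtain ⟨l, hl⟩ := D.exists_g₀_mul (-(m₀ * D.N.val 1 1 - m₁ * D.N.val 1 0))
        (-(-m₀ * D.N.val 0 1 + m₁ * D.N.val 0 0))
      refine ⟨n - 1, -(m₀ * D.N.val 1 1 - m₁ * D.N.val 1 0),
        -(-m₀ * D.N.val 0 1 + m₁ * D.N.val 0 0), l - k, ?_⟩
      rw [hl]
      have := D.det_eq
      congr 1
      · ring
      · linear_combination m₀ * this
      · linear_combination m₁ * this
      · ring
    · refine ⟨n, m₀ - 1, m₁, k, ?_⟩
      rw [g_zero_mul]; congr 1; ring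
    · refine ⟨n, m₀, m₁ - 1, k + D.r * m₀, ?_⟩
      rw [g_one_mul]; congr 1 <;> ring
    · refine ⟨n, m₀, m₁, k - 1, ?_⟩
      rw [g₃_mul]; congr 1; ring

theorem normalForm_im (n m₀ m₁ k : ℤ) (x : UpperHalfPlane × ℂ) :
    (D.normalForm n m₀ m₁ k x).1.im = D.α ^ n * x.1.im := by
  simp [normalForm, affineAut]

theorem normalForm_re (n m₀ m₁ k : ℤ) (x : UpperHalfPlane × ℂ) :
    (D.normalForm n m₀ m₁ k x).1.re = m₀ * D.a 0 + m₁ * D.a 1 + D.α ^ n * x.1.re := by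
  simp [normalForm, affineAut]

theorem normalForm_snd_im (n m₀ m₁ k : ℤ) (x : UpperHalfPlane × ℂ) :
    (D.normalForm n m₀ m₁ k x).2.im =
      (-1) ^ n * x.2.im + (m₀ * D.b 0 + m₁ * D.b 1) * (D.α ^ n * x.1.im) := by
  rw [normalForm, affineAut_snd_im]
  simp; ring

theorem normalForm_snd_re (n m₀ m₁ k : ℤ) (x : UpperHalfPlane × ℂ) :
    (D.normalForm n m₀ m₁ k x).2.re =
      (-1) ^ n * x.2.re + (m₀ * D.b 0 + m₁ * D.b 1) * (D.α ^ n * x.1.re) + D.const m₀ m₁ k := by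
  rw [normalForm, affineAut_snd_re]
  simp; ring

theorem finite_int {u : ℝ} (hu : u ≠ 0) (v R : ℝ) : {k : ℤ | |k * u + v| ≤ R}.Finite := by
  apply (Set.finite_Icc (-⌈(R + |v|) / |u|⌉) ⌈(R + |v|) / |u|⌉).subset
  intro k hk
  have h1 : |(k : ℝ)| ≤ (R + |v|) / |u| := by
    rw [le_div_iff₀ (abs_pos.mpr hu), ← abs_mul]
    have := abs_sub_abs_le_abs_sub (k * u) (-v)
    rw [sub_neg_eq_add, abs_neg] at this
    have hk' : |k * u + v| ≤ R := hk
    linarith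
  have h2 := h1.trans (Int.le_ceil _)
  rw [← Int.cast_abs, Int.cast_le] at h2
  exact abs_le.mp h2

instance : IsCancelSMul D.group (UpperHalfPlane × ℂ) := by
  rw [isCancelSMul_iff_eq_one_of_smul_eq]
  rintro ⟨g, hg⟩ x hx
  obtain ⟨n, m₀, m₁, k, rfl⟩ := D.exists_normalForm hg
  rw [smul_def] at hx
  have hα := D.one_lt_α
  have him := x.1.im_pos
  have h1 : D.α ^ n = 1 := by
    have h := D.normalForm_im n m₀ m₁ k x
    rw [hx] at h
    exact (mul_eq_right₀ him.ne').mp h.symm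
  have hn : n = 0 := by
    rwa [zpow_eq_one_iff_right₀ D.α_pos.le hα.ne'] at h1
  subst hn
  have ha := D.normalForm_re 0 m₀ m₁ k x
  have hb := D.normalForm_snd_im 0 m₀ m₁ k x
  have hc := D.normalForm_snd_re 0 m₀ m₁ k x
  rw [hx] at ha hb hc
  simp at ha hb
  have hb' := hb.resolve_right him.ne'
  have hm₀ : m₀ = 0 := by
    have : m₀ * D.θ = 0 := by unfold θ; linear_combination D.b 1 * ha - D.a 1 * hb'
    exact_mod_cast (mul_eq_zero.mp this).resolve_right D.θ_ne_zero
  have hm₁ : m₁ = 0 := by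
    have : m₁ * D.θ = 0 := by unfold θ; linear_combination D.a 0 * hb' - D.b 0 * ha
    exact_mod_cast (mul_eq_zero.mp this).resolve_right D.θ_ne_zero
  subst hm₀ hm₁
  have hk : k = 0 := by
    simpa [const, D.θ_ne_zero, D.r_ne_zero] using hc
  subst hk
  apply Subtype.ext
  ext y <;> simp [normalForm, affineAut, const]

instance : ProperlyDiscontinuousSMul D.group (UpperHalfPlane × ℂ) := by
  refine ⟨fun {K L} hK hL => ?_⟩
  have hα := D.one_lt_α
  have hlog : Real.log D.α ≠ 0 := (Real.log_pos hα).ne'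
  have hθ := D.θ_ne_zero
  have hτ : -(D.θ / D.r) ≠ 0 := neg_ne_zero.mpr (div_ne_zero hθ D.r_ne)
  let F : UpperHalfPlane × ℂ → ℝ := fun x =>
    |x.1.re| + |x.1.im| + x.1.im⁻¹ + |x.2.re| + |x.2.im|
  have hF : Continuous F := by
    have h1 := UpperHalfPlane.continuous_re
    have h2 := UpperHalfPlane.continuous_im
    have h3 : Continuous fun x : UpperHalfPlane × ℂ => x.1.im⁻¹ :=
      (h2.comp continuous_fst).inv₀ fun x => x.1.im_pos.ne'
    fun_prop
  obtain ⟨R, hR⟩ := ((hK.union hL).image hF).bddAbove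
  have hR' : ∀ x ∈ K ∪ L, F x ≤ R := fun x hx => hR ⟨x, hx, rfl⟩
  have hbd : ∀ x ∈ K ∪ L, |x.1.re| ≤ R ∧ x.1.im ≤ R ∧ x.1.im⁻¹ ≤ R ∧ |x.2.re| ≤ R ∧
      |x.2.im| ≤ R := by
    intro x hx
    have := hR' x hx
    have h0 := abs_nonneg x.1.re
    have h1 := abs_nonneg x.2.re
    have h2 := abs_nonneg x.2.im
    have h3 := x.1.im_pos
    have h4 := inv_pos.mpr h3
    have h5 := le_abs_self x.1.im
    simp only [F] at this
    refine ⟨?_, ?_, ?_, ?_, ?_⟩ <;> linarith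
  let T : ℝ := (R + R * R * R) * (|D.a 0| + |D.a 1| + |D.b 0| + |D.b 1|) +
    (R + R) * R * (|D.a 0| + |D.a 1| + |D.b 0| + |D.b 1|)
  have hfin : (⋃ n ∈ {n : ℤ | |n * Real.log D.α + 0| ≤ Real.log (R * R)},
      ⋃ m₀ ∈ {m : ℤ | |m * D.θ + 0| ≤ T}, ⋃ m₁ ∈ {m : ℤ | |m * D.θ + 0| ≤ T},
      D.normalForm n m₀ m₁ '' {k : ℤ | |k * (-(D.θ / D.r)) + D.const m₀ m₁ 0| ≤
        R + R + (R + R) * R * (R * R * R)}).Finite :=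
    (finite_int hlog _ _).biUnion fun n _ => (finite_int hθ _ _).biUnion fun m₀ _ =>
      (finite_int hθ _ _).biUnion fun m₁ _ => (finite_int hτ _ _).image _
  refine (hfin.preimage (f := fun g : D.group => g.1) Subtype.val_injective.injOn).subset ?_
  rintro ⟨g, hg⟩ ⟨y, ⟨x, hx, hxy⟩, hy⟩
  obtain ⟨n, m₀, m₁, k, rfl⟩ := D.exists_normalForm hg
  change D.normalForm n m₀ m₁ k x = y at hxy
  have h1 := D.normalForm_im n m₀ m₁ k x
  have h2 := D.normalForm_re n m₀ m₁ k x
  have h3 := D.normalForm_snd_im n m₀ m₁ k x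
  have h4 := D.normalForm_snd_re n m₀ m₁ k x
  rw [hxy] at h1 h2 h3 h4
  obtain ⟨x1, x2, x3, x4, x5⟩ := hbd x (.inl hx)
  obtain ⟨y1, y2, y3, y4, y5⟩ := hbd y (.inr hy)
  have px := x.1.im_pos
  have py := y.1.im_pos
  have pn : 0 < D.α ^ n := zpow_pos D.α_pos n
  have R0 : 0 < R := px.trans_le x2
  have hn1 : D.α ^ n ≤ R * R := by
    have : D.α ^ n = y.1.im * x.1.im⁻¹ := by rw [h1]; field_simp
    rw [this]; gcongr
  have hn2 : (D.α ^ n)⁻¹ ≤ R * R := by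
    have : (D.α ^ n)⁻¹ = x.1.im * y.1.im⁻¹ := by rw [h1]; field_simp
    rw [this]; gcongr
  have hε : ∀ t : ℝ, |(-1) ^ n * t| = |t| := by
    intro t; rw [abs_mul, abs_zpow]; simp
  have hA : |m₀ * D.a 0 + m₁ * D.a 1| ≤ R + R * R * R := by
    have : m₀ * D.a 0 + m₁ * D.a 1 = y.1.re - D.α ^ n * x.1.re := by rw [h2]; ring
    rw [this]
    refine (abs_sub _ _).trans ?_
    rw [abs_mul, abs_of_pos pn]
    gcongr
  have hB : |m₀ * D.b 0 + m₁ * D.b 1| ≤ (R + R) * R := by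
    have : m₀ * D.b 0 + m₁ * D.b 1 = (y.2.im - (-1) ^ n * x.2.im) * y.1.im⁻¹ := by
      rw [h3, h1]; field_simp; ring
    rw [this, abs_mul, abs_of_pos (inv_pos.mpr py)]
    have : |y.2.im - (-1) ^ n * x.2.im| ≤ R + R := by
      refine (abs_sub _ _).trans ?_
      rw [hε]; gcongr
    gcongr
  have hAB : ∀ u v : ℝ, |u| ≤ |D.a 0| + |D.a 1| + |D.b 0| + |D.b 1| →
      |v| ≤ |D.a 0| + |D.a 1| + |D.b 0| + |D.b 1| →
      |(m₀ * D.a 0 + m₁ * D.a 1) * u - (m₀ * D.b 0 + m₁ * D.b 1) * v| ≤ T := by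
    intro u v hu hv
    refine (abs_sub _ _).trans ?_
    rw [abs_mul, abs_mul]
    simp only [T]
    gcongr
  have pa0 := abs_nonneg (D.a 0)
  have pa1 := abs_nonneg (D.a 1)
  have pb0 := abs_nonneg (D.b 0)
  have pb1 := abs_nonneg (D.b 1)
  simp only [Set.mem_preimage, Set.mem_iUnion, Set.mem_ofPred_eq, Set.mem_image, exists_prop]
  refine ⟨n, ?_, m₀, ?_, m₁, ?_, k, ?_, rfl⟩
  · rw [add_zero, ← Real.log_zpow, abs_le, neg_le, ← Real.log_inv]
    exact ⟨Real.log_le_log (inv_pos.mpr pn) hn2, Real.log_le_log pn hn1⟩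
  · have := hAB (D.b 1) (D.a 1) (by linarith) (by linarith)
    convert this using 2
    unfold θ; ring
  · have := hAB (-D.b 0) (-D.a 0) (by rw [abs_neg]; linarith) (by rw [abs_neg]; linarith)
    convert this using 2
    unfold θ; ring
  · have : k * (-(D.θ / D.r)) + D.const m₀ m₁ 0 =
        y.2.re - (-1) ^ n * x.2.re - (m₀ * D.b 0 + m₁ * D.b 1) * (D.α ^ n * x.1.re) := by
      rw [h4]; simp [const]; ring
    rw [this]
    refine (abs_sub _ _).trans (add_le_add ((abs_sub _ _).trans ?_) ?_)
    · rw [hε]; gcongr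
    · rw [abs_mul, abs_mul, abs_of_pos pn]; gcongr

/-- The Inoue surface `S⁻_{N,p,q,r,a,b} = (ℍ × ℂ) / G` of type `S⁻`. Its topology is the quotient
topology and its charts are local inverses of the projection `ℍ × ℂ → (ℍ × ℂ) / G`. -/
noncomputable def surface : ComplexManifold where
  carrier := MulAction.orbitRel.Quotient D.group (UpperHalfPlane × ℂ)
  model := ℂ × ℂ
  secondCountable := ContinuousConstSMul.secondCountableTopology
  chartedSpace := MulAction.instChartedSpaceQuotient (H := ModelProd ℂ ℂ)
  isManifold := by
    rw [modelWithCornersSelf_prod]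
    refine isManifold_orbitQuotient (M := UpperHalfPlane × ℂ) (𝓘(ℂ).prod 𝓘(ℂ)) ?_
    rintro ⟨g, hg⟩
    obtain ⟨n, m₀, m₁, k, rfl⟩ := D.exists_normalForm hg
    exact contMDiff_affineAut _ _ _ _ _

end InoueSMinusData

/-!
The fundamental group of an Inoue surface of type `S⁻` determines it up to finitely many choices,
and in fact up to biholomorphism and the sign of the eigenvector `a`.

The surface is the quotient of the contractible space `ℍ × ℂ` by the free and properly discontinuous
group `G`, so a homotopy equivalence between two surfaces gives an isomorphism `φ` of their groups
(`IsQuotientCoveringMap.nonempty_mulEquiv_of_homotopyEquiv`). The group of `D` is governed by the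
relations `g₃ g₀ g₃ = g₀`, `g₂ g₁ g₃ ^ r = g₁ g₂` and `g₀ g_i = g₁ ^ n_{i1} g₂ ^ n_{i2} g₃ ^ p_i g₀`
with `(p₁, p₂) = (p, q)`. Since `det (N - 1) = - tr N ≠ 0`, they imply that every homomorphism to
`ℤ` kills `g₁`, `g₂`, `g₃`; hence the isomorphism maps these three to elements
`(w, z) ↦ (w + A_i, z + B_i w + C_i)` of the group of `D'`. Comparing coefficients in the relations,
`A` and `B` are eigenvectors of `N` itself, `φ(g₀)` multiplies `w` by `α` up to a translation, and
`φ(g₃)` is the translation of `z` by `-det (A, B) / r`. An affine change of coordinates brings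
`φ(g₀)` into the form `(w, z) ↦ (α w, -z)`, and then the constants `C_i` solve the linear equation
that defines `c`. So the surface of `D'` is biholomorphic to a surface with the integers
`N, p, q, r` of `D` and with eigenvectors `A`, `B` (`InoueSMinusData.exists_conjugate_of_mulEquiv`).

The eigenvectors are proportional to `a` and `b`. Rescaling `w` by a positive and `z` by a nonzero
real number changes `a` by any positive and `b` by any nonzero factor
(`InoueSMinusData.conjugate_of_pos`), so that only the sign of `a` is left, and two surfaces with the
same sign are biholomorphic. Biholomorphic surfaces are fibres of the constant map from one of them
to a point, which is proper because the surfaces are compact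
(`InoueSMinusData.Conjugate.deformationEquivalent`).
-/

/-! ### Deck groups of homotopy equivalent quotients -/

namespace IsQuotientCoveringMap

/-- Homotopy equivalent quotients of simply connected spaces have isomorphic deck groups. -/
theorem nonempty_mulEquiv_of_homotopyEquiv {E E' X X' G G' : Type*} [TopologicalSpace E]
    [TopologicalSpace E'] [TopologicalSpace X] [TopologicalSpace X'] [Group G] [Group G']
    [MulAction G E] [MulAction G' E'] [SimplyConnectedSpace E] [SimplyConnectedSpace E']
    {p : E → X} {p' : E' → X'} (hp : IsQuotientCoveringMap p G) (hp' : IsQuotientCoveringMap p' G')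
    (f : ContinuousMap.HomotopyEquiv X X') : Nonempty (G ≃* G') := by
  obtain ⟨e⟩ : Nonempty E := inferInstance
  obtain ⟨e', he'⟩ := hp'.surjective (f (p e))
  let F := FundamentalGroupoidFunctor.equivOfHomotopyEquiv f
  have h1 := hp.fundamentalGroupEquiv ⟨e, rfl⟩
  have h2 : FundamentalGroup X' (f (p e)) ≃* G'ᵐᵒᵖ := hp'.fundamentalGroupEquiv ⟨e', he'⟩
  have h3 : FundamentalGroup X (p e) ≃* FundamentalGroup X' (f (p e)) :=
    F.fullyFaithfulFunctor.mulEquivEnd _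
  exact ⟨MulEquiv.unop (h1.symm.trans (h3.trans h2))⟩

end IsQuotientCoveringMap

/-! ### Holomorphic maps from and to orbit spaces -/

section OrbitQuotient

variable {M G : Type*} [TopologicalSpace M] [Group G] [MulAction G M]
  [ProperlyDiscontinuousSMul G M] [ContinuousConstSMul G M] [IsCancelSMul G M]
  [T2Space M] [LocallyCompactSpace M] {E : Type*} [NormedAddCommGroup E] [NormedSpace ℂ E]
  {H : Type*} [TopologicalSpace H] (I : ModelWithCorners ℂ E H) [ChartedSpace H M]
  [IsManifold I ω M]

/-- Near a suitable representative `x₀` of `q`, the projection to the orbit space is a holomorphic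
map, with a holomorphic local inverse `s`: in the charts at `x₀` and `q`, both are the identity. -/
theorem exists_contMDiffAt_localInverse (hG : ∀ g : G, ContMDiff I I ω fun x : M => g • x)
    (q : MulAction.orbitRel.Quotient G M) :
    ∃ (x₀ : M) (s : MulAction.orbitRel.Quotient G M → M), Quotient.mk _ x₀ = q ∧ s q = x₀ ∧
      (∀ᶠ y in nhds q, Quotient.mk (MulAction.orbitRel G M) (s y) = y) ∧ ContMDiffAt I I ω s q ∧
      ContMDiffAt I I ω
        (Quotient.mk (MulAction.orbitRel G M) : M → MulAction.orbitRel.Quotient G M) x₀ := by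
  have := isManifold_orbitQuotient I hG
  have hloc : IsLocalHomeomorph (Quotient.mk (MulAction.orbitRel G M)) :=
    isQuotientCoveringMap_quotientMk_of_properlyDiscontinuousSMul.isCoveringMap.isLocalHomeomorph
  obtain ⟨x₀, hx₀, hc⟩ : ∃ x₀ : M, Quotient.mk (MulAction.orbitRel G M) x₀ = q ∧
      chartAt H q = (hloc.localInverseAt x₀).trans (chartAt H x₀) :=
    ⟨_, (Quotient.mk_surjective (s := MulAction.orbitRel G M)).hasRightInverse.choose_spec q, rfl⟩
  have hs : hloc.localInverseAt x₀ q = x₀ := by simp [← hx₀]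
  have hq : q ∈ (hloc.localInverseAt x₀).source := by simp [← hx₀]
  have hchart : chartAt H q q = chartAt H x₀ x₀ := by simp [hc, hs]
  refine ⟨x₀, hloc.localInverseAt x₀, hx₀, hs, ?_, ?_, ?_⟩
  · filter_upwards [(hloc.localInverseAt x₀).open_source.mem_nhds hq] with y hy
    exact hloc.apply_localInverseAt_of_mem hy
  · have h1 : ContMDiffAt I I ω (chartAt H q) q :=
      contMDiffOn_chart.contMDiffAt ((chartAt H q).open_source.mem_nhds (mem_chart_source H q))
    have h2 : ContMDiffAt I I ω (chartAt H x₀).symm (chartAt H q q) := by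
      rw [hchart]
      exact contMDiffOn_chart_symm.contMDiffAt
        ((chartAt H x₀).open_target.mem_nhds (mem_chart_target H x₀))
    refine (h2.comp q h1).congr_of_eventuallyEq ?_
    filter_upwards [(chartAt H q).open_source.mem_nhds (mem_chart_source H q)] with y hy
    rw [hc] at hy ⊢
    exact ((chartAt H x₀).left_inv hy.2).symm
  · have h1 : ContMDiffAt I I ω (chartAt H x₀) x₀ :=
      contMDiffOn_chart.contMDiffAt ((chartAt H x₀).open_source.mem_nhds (mem_chart_source H x₀))
    have h2 : ContMDiffAt I I ω (chartAt H q).symm (chartAt H x₀ x₀) := by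
      rw [← hchart]
      exact contMDiffOn_chart_symm.contMDiffAt
        ((chartAt H q).open_target.mem_nhds (mem_chart_target H q))
    refine (h2.comp x₀ h1).congr_of_eventuallyEq ?_
    filter_upwards [(chartAt H x₀).open_source.mem_nhds (mem_chart_source H x₀)] with y hy
    simp [hc, (chartAt H x₀).left_inv hy]

theorem contMDiff_orbitQuotient_mk (hG : ∀ g : G, ContMDiff I I ω fun x : M => g • x) :
    ContMDiff I I ω
      (Quotient.mk (MulAction.orbitRel G M) : M → MulAction.orbitRel.Quotient G M) := by
  intro x
  obtain ⟨x₀, -, hx₀, -, -, -, h⟩ := exists_contMDiffAt_localInverse I hG (Quotient.mk _ x)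
  obtain ⟨g, rfl⟩ : ∃ g : G, g • x = x₀ := Quotient.exact hx₀
  -- The projection is invariant under `g`, which moves `x` to the good representative.
  refine (h.comp x (hG g x)).congr_of_eventuallyEq (.of_forall fun y => ?_)
  exact Quotient.sound ⟨g⁻¹, by simp⟩

theorem contMDiff_of_comp_orbitQuotient_mk (hG : ∀ g : G, ContMDiff I I ω fun x : M => g • x)
    {E' : Type*} [NormedAddCommGroup E'] [NormedSpace ℂ E']
    {H' : Type*} [TopologicalSpace H'] {I' : ModelWithCorners ℂ E' H'} {N : Type*}
    [TopologicalSpace N] [ChartedSpace H' N] {f : MulAction.orbitRel.Quotient G M → N}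
    (hf : ContMDiff I I' ω fun x : M => f (Quotient.mk _ x)) : ContMDiff I I' ω f := by
  intro q
  obtain ⟨x₀, s, -, -, hs, hsq, -⟩ := exists_contMDiffAt_localInverse I hG q
  refine ((hf (s q)).comp q hsq).congr_of_eventuallyEq ?_
  filter_upwards [hs] with y hy
  exact congrArg f hy.symm

end OrbitQuotient

/-! ### The universal covering of an Inoue surface -/

namespace InoueSMinusData

variable (D : InoueSMinusData)

theorem contMDiff_smul (g : D.group) :
    ContMDiff (𝓘(ℂ).prod 𝓘(ℂ)) (𝓘(ℂ).prod 𝓘(ℂ)) ω fun x : UpperHalfPlane × ℂ => g • x := by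
  obtain ⟨g, hg⟩ := g
  obtain ⟨n, m₀, m₁, k, rfl⟩ := D.exists_normalForm hg
  exact contMDiff_affineAut _ _ _ _ _

/-- The universal covering `ℍ × ℂ → S⁻`. -/
noncomputable def proj (x : UpperHalfPlane × ℂ) : D.surface := Quotient.mk (MulAction.orbitRel D.group _) x

theorem isQuotientCoveringMap_proj : IsQuotientCoveringMap D.proj D.group :=
  isQuotientCoveringMap_quotientMk_of_properlyDiscontinuousSMul

theorem proj_eq_iff {x y : UpperHalfPlane × ℂ} :
    D.proj x = D.proj y ↔ ∃ g ∈ D.group, g y = x := by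
  rw [D.isQuotientCoveringMap_proj.apply_eq_iff_mem_orbit]
  exact ⟨fun ⟨g, hg⟩ => ⟨g.1, g.2, hg⟩, fun ⟨g, hg, h⟩ => ⟨⟨g, hg⟩, h⟩⟩

theorem contMDiff_proj : ContMDiff (𝓘(ℂ).prod 𝓘(ℂ)) 𝓘(ℂ, D.surface.model) ω D.proj := by
  have key : ∀ J : ModelWithCorners ℂ (ℂ × ℂ) (ModelProd ℂ ℂ), J = 𝓘(ℂ).prod 𝓘(ℂ) →
      ContMDiff (𝓘(ℂ).prod 𝓘(ℂ)) J ω (Quotient.mk (MulAction.orbitRel D.group _) :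
        UpperHalfPlane × ℂ → MulAction.orbitRel.Quotient D.group (UpperHalfPlane × ℂ)) := by
    rintro J rfl
    exact contMDiff_orbitQuotient_mk (𝓘(ℂ).prod 𝓘(ℂ)) D.contMDiff_smul
  exact key 𝓘(ℂ, ℂ × ℂ) modelWithCornersSelf_prod

theorem holomorphic_of_comp_proj {X : ComplexManifold} {f : D.surface → X}
    (hf : ContMDiff (𝓘(ℂ).prod 𝓘(ℂ)) 𝓘(ℂ, X.model) ω (f ∘ D.proj)) :
    ComplexManifold.Holomorphic f := by
  have key : ∀ J : ModelWithCorners ℂ (ℂ × ℂ) (ModelProd ℂ ℂ), J = 𝓘(ℂ).prod 𝓘(ℂ) →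
      ∀ f : MulAction.orbitRel.Quotient D.group (UpperHalfPlane × ℂ) → X,
      ContMDiff (𝓘(ℂ).prod 𝓘(ℂ)) 𝓘(ℂ, X.model) ω (fun x => f (Quotient.mk _ x)) →
      ContMDiff J 𝓘(ℂ, X.model) ω f := by
    rintro J rfl f hf
    exact contMDiff_of_comp_orbitQuotient_mk (𝓘(ℂ).prod 𝓘(ℂ)) D.contMDiff_smul hf
  exact key 𝓘(ℂ, ℂ × ℂ) modelWithCornersSelf_prod f hf

theorem nonempty_mulEquiv_of_homotopyEquivalent {D D' : InoueSMinusData}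
    (h : ComplexManifold.HomotopyEquivalent D.surface D'.surface) :
    Nonempty (D.group ≃* D'.group) :=
  have : ContractibleSpace (UpperHalfPlane × ℂ) := inferInstance
  D.isQuotientCoveringMap_proj.nonempty_mulEquiv_of_homotopyEquiv D'.isQuotientCoveringMap_proj
    h.some

end InoueSMinusData

/-! ### The trivial deformation -/

namespace ComplexManifold

/-- The zero-dimensional complex manifold with one point. -/
noncomputable def point : ComplexManifold where
  carrier := PUnit
  model := PUnit

/-- Biholomorphic compact connected manifolds are both fibres of the constant map from one of them
to a point. -/
theorem DeformationEquivalent.of_biholomorphic {S S' : ComplexManifold} [CompactSpace S']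
    [ConnectedSpace S'] (f : S → S') (g : S' → S) (hf : Holomorphic f) (hg : Holomorphic g)
    (hgf : Function.LeftInverse g f) (hfg : Function.RightInverse g f) :
    DeformationEquivalent S S' := by
  have hconst : IsSmoothProper (X := S') (B := point) fun _ => PUnit.unit :=
    ⟨contMDiff_const, fun x y => ⟨0, Subsingleton.elim (α := PUnit) _ _⟩,
      (isProperMap_iff_isCompact_preimage (f := fun _ : S' => PUnit.unit)).2
        ⟨continuous_const, fun K _ => (K.toFinite.isClosed.preimage continuous_const).isCompact⟩⟩
  have : ConnectedSpace point := inferInstanceAs (ConnectedSpace PUnit)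
  refine ⟨S', point, fun _ => PUnit.unit, PUnit.unit, PUnit.unit, inferInstance, this, hconst,
    ⟨f, hf, fun s => ?_, ?_, ?_⟩, ⟨id, contMDiff_id, fun s => ?_, Topology.IsEmbedding.id, ?_⟩⟩
  · have h1 := hf.mdifferentiable (by simp) s
    have h2 := hg.mdifferentiable (by simp) (f s)
    have h := mfderiv_comp s h2 h1
    rw [show g ∘ f = id from funext hgf, mfderiv_id] at h
    refine Function.LeftInverse.injective (g := mfderiv 𝓘(ℂ, S'.model) 𝓘(ℂ, S.model) g (f s)) ?_
    intro v
    exact (DFunLike.congr_fun h v).symm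
  · exact (Homeomorph.mk ⟨f, g, hgf, hfg⟩ hf.continuous hg.continuous).isEmbedding
  · exact hfg.surjective.range_eq.trans (Set.eq_univ_of_forall fun _ => rfl).symm
  · rw [mfderiv_id]; exact fun _ _ h => h
  · exact Set.range_id.trans (Set.eq_univ_of_forall fun _ => rfl).symm

end ComplexManifold

/-! ### Generators and relations of the deck group -/

/-- A sequence in a group with `f (n + 1) = x * f n` is `x ^ n * f 0`. -/
theorem eq_zpow_mul_of_mul_eq_succ {G : Type*} [Group G] {x : G} {f : ℤ → G}
    (h : ∀ n, x * f n = f (n + 1)) (n : ℤ) : f n = x ^ n * f 0 := by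
  induction n with
  | zero => simp
  | succ n ih => rw [← h, ih, zpow_add_one, ← mul_assoc, (Commute.zpow_self x _).eq]
  | pred n ih =>
    have h1 := h (-n - 1)
    rw [sub_add_cancel, ih] at h1
    rw [zpow_sub_one, ← (Commute.refl x).inv_left.zpow_right _ |>.eq, mul_assoc, ← h1,
      inv_mul_cancel_left]

namespace InoueSMinusData

section Generators

variable (D : InoueSMinusData)

theorem g₀_mem : D.g₀ ∈ D.group := Subgroup.subset_closure (by simp)

theorem g₃_mem : D.g₃ ∈ D.group := Subgroup.subset_closure (by simp)

theorem g_mem (i : Fin 2) : D.g i ∈ D.group :=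
  Subgroup.subset_closure (by fin_cases i <;> simp)

theorem normalForm_eq (n m₀ m₁ k : ℤ) :
    D.normalForm n m₀ m₁ k = D.g 0 ^ m₀ * D.g 1 ^ m₁ * D.g₃ ^ k * D.g₀ ^ n := by
  have h0 := eq_zpow_mul_of_mul_eq_succ (fun m => D.g_zero_mul n m m₁ k) m₀
  have h1 := eq_zpow_mul_of_mul_eq_succ (f := fun m => D.normalForm n 0 m k)
    (fun m => by simpa using D.g_one_mul n 0 m k) m₁
  have h2 := eq_zpow_mul_of_mul_eq_succ (fun m => D.g₃_mul n 0 0 m) k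
  have h3 := eq_zpow_mul_of_mul_eq_succ (f := fun m => D.normalForm m 0 0 0) (x := D.g₀)
    (fun m => by
      simp only [g₀, normalForm, affineAut_mul]
      apply affineAut_congr <;> simp [const, zpow_add₀ D.α_pos.ne', zpow_add, mul_comm]) n
  have h4 : D.normalForm 0 0 0 0 = 1 := by
    ext x <;> simp [normalForm, affineAut, const]
  rw [h0, h1, h2, h3, h4, mul_one]
  simp only [mul_assoc]

theorem normalForm_mem (n m₀ m₁ k : ℤ) : D.normalForm n m₀ m₁ k ∈ D.group := by
  rw [normalForm_eq]
  have := D.g_mem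
  have := D.g₀_mem
  have := D.g₃_mem
  apply_rules [mul_mem, zpow_mem]

theorem g₀_mul_g (i : Fin 2) : D.g₀ * D.g i =
    D.g 0 ^ D.N.val i 0 * D.g 1 ^ D.N.val i 1 * D.g₃ ^ (![D.p, D.q] i) * D.g₀ := by
  have h := D.normalForm_eq 1 (D.N.val i 0) (D.N.val i 1) (![D.p, D.q] i)
  rw [zpow_one] at h
  rw [← h]
  simp only [g₀, g, normalForm, affineAut_mul]
  apply affineAut_congr
  · simp
  · simp [D.eq_a]
  · simp
  · have := D.α_pos.ne'
    simp [D.eq_b]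
    field_simp
  · have hc := D.eq_c i
    have hi : ![(D.p : ℝ), D.q] i = ((![D.p, D.q] i : ℤ) : ℝ) := by fin_cases i <;> rfl
    rw [hi] at hc
    simp [const, e] at hc ⊢
    linear_combination -hc

theorem g₃_mul_g₀_mul_g₃ : D.g₃ * D.g₀ * D.g₃ = D.g₀ := by
  simp only [g₀, g₃, affineAut_mul]
  apply affineAut_congr <;> simp

theorem g_one_mul_g_zero : D.g 1 * D.g 0 * D.g₃ ^ D.r = D.g 0 * D.g 1 := by
  have h1 := D.g_one_mul 0 1 0 D.r
  have h2 := D.normalForm_eq 0 1 0 D.r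
  have h3 := D.normalForm_eq 0 1 1 0
  simp at h1 h2 h3
  rw [mul_assoc, ← h2, h1, h3]

end Generators

/-! ### Biholomorphic Inoue surfaces -/

/-- The deck groups of two Inoue surfaces are conjugate by a biholomorphic map of `ℍ × ℂ`. -/
def Conjugate (D D' : InoueSMinusData) : Prop :=
  ∃ Φ : (UpperHalfPlane × ℂ) ≃ₜ (UpperHalfPlane × ℂ),
    ContMDiff (𝓘(ℂ).prod 𝓘(ℂ)) (𝓘(ℂ).prod 𝓘(ℂ)) ω Φ ∧
    ContMDiff (𝓘(ℂ).prod 𝓘(ℂ)) (𝓘(ℂ).prod 𝓘(ℂ)) ω Φ.symm ∧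
    D.group.map (MulAut.conj Φ).toMonoidHom = D'.group

variable {D D' D'' : InoueSMinusData}

theorem map_conj_symm {Φ : (UpperHalfPlane × ℂ) ≃ₜ (UpperHalfPlane × ℂ)}
    (h : D.group.map (MulAut.conj Φ).toMonoidHom = D'.group) :
    D'.group.map (MulAut.conj Φ.symm).toMonoidHom = D.group := by
  rw [← h, Subgroup.map_map]
  convert Subgroup.map_id _
  ext x : 1
  change Φ⁻¹ * (Φ * x * Φ⁻¹) * Φ = x
  group

theorem Conjugate.symm (h : Conjugate D D') : Conjugate D' D := by
  obtain ⟨Φ, h1, h2, h3⟩ := h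
  exact ⟨Φ.symm, h2, h1, map_conj_symm h3⟩

theorem Conjugate.trans (h : Conjugate D D') (h' : Conjugate D' D'') : Conjugate D D'' := by
  obtain ⟨Φ, h1, h2, h3⟩ := h
  obtain ⟨Ψ, h1', h2', h3'⟩ := h'
  refine ⟨Ψ * Φ, h1'.comp h1, h2.comp h2', ?_⟩
  rw [← h3', ← h3, Subgroup.map_map, map_mul]
  rfl

instance : ConnectedSpace D.surface :=
  have : ContractibleSpace (UpperHalfPlane × ℂ) := inferInstance
  inferInstanceAs (ConnectedSpace (Quotient (MulAction.orbitRel D.group (UpperHalfPlane × ℂ))))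

instance : CompactSpace D.surface := by
  have hα := D.one_lt_α
  have hlog : 0 < Real.log D.α := Real.log_pos hα
  have hθ := D.θ_ne_zero
  have hτ : D.θ / D.r ≠ 0 := div_ne_zero hθ D.r_ne
  -- A fundamental domain, parametrized by the unit cube.
  let P : ℝ × ℝ × ℝ × ℝ → UpperHalfPlane × ℂ := fun t =>
    (⟨⟨t.2.1 * D.a 0 + t.2.2.1 * D.a 1, Real.exp (t.1 * Real.log D.α)⟩, Real.exp_pos _⟩,
      ⟨t.2.2.2 * (D.θ / D.r),
        (t.2.1 * D.b 0 + t.2.2.1 * D.b 1) * Real.exp (t.1 * Real.log D.α)⟩)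
  have hP : Continuous P := by
    have hC : ∀ f g : ℝ × ℝ × ℝ × ℝ → ℝ, Continuous f → Continuous g →
        Continuous fun t => (⟨f t, g t⟩ : ℂ) := fun f g hf hg =>
      Complex.equivRealProdCLM.symm.continuous.comp (hf.prodMk hg)
    refine Continuous.prodMk ?_ (hC _ _ (by fun_prop) (by fun_prop))
    rw [UpperHalfPlane.isEmbedding_coe.continuous_iff]
    exact hC _ _ (by fun_prop) (by fun_prop)
  have hcube : IsCompact (Set.Icc (0 : ℝ) 1 ×ˢ Set.Icc (0 : ℝ) 1 ×ˢ Set.Icc (0 : ℝ) 1 ×ˢ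
      Set.Icc (0 : ℝ) 1) :=
    isCompact_Icc.prod (isCompact_Icc.prod (isCompact_Icc.prod isCompact_Icc))
  have hI : ∀ t : ℝ, Int.fract t ∈ Set.Icc (0 : ℝ) 1 :=
    fun t => ⟨Int.fract_nonneg t, (Int.fract_lt_one t).le⟩
  rw [← isCompact_univ_iff]
  convert (hcube.image hP).image D.contMDiff_proj.continuous
  symm
  rw [Set.eq_univ_iff_forall]
  intro q
  obtain ⟨x, rfl⟩ := D.isQuotientCoveringMap_proj.surjective q
  -- `g₀ ^ n` brings `im w` into `[1, α)`, then `g₁ ^ m₀ * g₂ ^ m₁` brings `(re w, im z / im w)` into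
  -- the parallelogram spanned by `(a₁, b₁)` and `(a₂, b₂)`, then `g₃ ^ k` brings `re z` into an
  -- interval of length `|θ / r|`.
  let y := Real.log x.1.im / Real.log D.α
  let n := -⌊y⌋
  have hv : D.α ^ n * x.1.im = Real.exp (Int.fract y * Real.log D.α) := by
    have h1 : Int.fract y * Real.log D.α = n * Real.log D.α + Real.log x.1.im := by
      have : y * Real.log D.α = Real.log x.1.im := by simp only [y]; field_simp
      rw [← this, Int.fract]; simp only [n]; push_cast; ring
    rw [h1, Real.exp_add, Real.exp_log x.1.im_pos, ← Real.log_zpow,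
      Real.exp_log (zpow_pos D.α_pos n)]
  let v := D.α ^ n * x.1.im
  have hv0 : v ≠ 0 := (mul_pos (zpow_pos D.α_pos n) x.1.im_pos).ne'
  let X := D.α ^ n * x.1.re
  let Y := (-1) ^ n * x.2.im / v
  let t₀ := (X * D.b 1 - Y * D.a 1) / D.θ
  let t₁ := (D.a 0 * Y - D.b 0 * X) / D.θ
  have hX : X = t₀ * D.a 0 + t₁ * D.a 1 := by
    simp only [t₀, t₁]; field_simp; unfold θ; ring
  have hY : Y = t₀ * D.b 0 + t₁ * D.b 1 := by
    simp only [t₀, t₁]; field_simp; unfold θ; ring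
  let m₀ := -⌊t₀⌋
  let m₁ := -⌊t₁⌋
  let Z := (-1) ^ n * x.2.re + (m₀ * D.b 0 + m₁ * D.b 1) * (D.α ^ n * x.1.re) + D.const m₀ m₁ 0
  let k := ⌊Z / (D.θ / D.r)⌋
  have hm₀ : Int.fract t₀ = t₀ + m₀ := by simp [Int.fract, m₀, sub_eq_add_neg]
  have hm₁ : Int.fract t₁ = t₁ + m₁ := by simp [Int.fract, m₁, sub_eq_add_neg]
  refine ⟨D.normalForm n m₀ m₁ k x, ⟨⟨Int.fract y, Int.fract t₀, Int.fract t₁,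
    Int.fract (Z / (D.θ / D.r))⟩, ⟨hI _, hI _, hI _, hI _⟩, ?_⟩, ?_⟩
  · symm
    refine Prod.ext (UpperHalfPlane.ext (Complex.ext ?_ ?_)) (Complex.ext ?_ ?_)
    · refine (D.normalForm_re _ _ _ _ _).trans ?_
      change _ = Int.fract t₀ * D.a 0 + Int.fract t₁ * D.a 1
      rw [hm₀, hm₁]
      linear_combination hX
    · exact (D.normalForm_im _ _ _ _ _).trans hv
    · rw [normalForm_snd_re]
      change _ = Int.fract (Z / (D.θ / D.r)) * (D.θ / D.r)
      rw [Int.fract, sub_mul, div_mul_cancel₀ _ hτ]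
      simp only [Z, k, const]
      push_cast; ring
    · rw [normalForm_snd_im]
      change _ = (Int.fract t₀ * D.b 0 + Int.fract t₁ * D.b 1) * _
      rw [← hv, hm₀, hm₁]
      have : (-1) ^ n * x.2.im = Y * v := by simp only [Y]; field_simp
      rw [this, hY]
      ring
  · exact D.proj_eq_iff.2 ⟨_, D.normalForm_mem n m₀ m₁ k, rfl⟩

theorem exists_holomorphic_of_map_conj {Φ : (UpperHalfPlane × ℂ) ≃ₜ (UpperHalfPlane × ℂ)}
    (hΦ : ContMDiff (𝓘(ℂ).prod 𝓘(ℂ)) (𝓘(ℂ).prod 𝓘(ℂ)) ω Φ)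
    (h : D.group.map (MulAut.conj Φ).toMonoidHom = D'.group) :
    ∃ f : D.surface → D'.surface, ComplexManifold.Holomorphic f ∧
      ∀ x, f (D.proj x) = D'.proj (Φ x) := by
  have hf : ∀ x y, MulAction.orbitRel D.group _ x y → D'.proj (Φ x) = D'.proj (Φ y) := by
    rintro _ y ⟨⟨g, hg⟩, rfl⟩
    refine D'.proj_eq_iff.2 ⟨Φ * g * Φ⁻¹, h ▸ ⟨g, hg, rfl⟩, ?_⟩
    exact congrArg (fun z => Φ (g z)) (Φ.symm_apply_apply y)
  refine ⟨Quotient.lift (fun x => D'.proj (Φ x)) hf, D.holomorphic_of_comp_proj ?_, fun _ => rfl⟩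
  exact D'.contMDiff_proj.comp hΦ

theorem Conjugate.deformationEquivalent (h : Conjugate D D') :
    ComplexManifold.DeformationEquivalent D.surface D'.surface := by
  obtain ⟨Φ, h1, h2, h3⟩ := h
  obtain ⟨f, hf, hf'⟩ := exists_holomorphic_of_map_conj h1 h3
  obtain ⟨g, hg, hg'⟩ := exists_holomorphic_of_map_conj h2 (map_conj_symm h3)
  refine .of_biholomorphic f g hf hg ?_ ?_
  · intro q
    obtain ⟨x, rfl⟩ := D.isQuotientCoveringMap_proj.surjective q
    rw [hf', hg', Φ.symm_apply_apply]
  · intro q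
    obtain ⟨x, rfl⟩ := D'.isQuotientCoveringMap_proj.surjective q
    rw [hg', hf', Φ.apply_symm_apply]

end InoueSMinusData

/-! ### Affine automorphisms of `ℍ × ℂ` -/

theorem affineAut_injective {s s' : {x : ℝ // 0 < x}} {A A' : ℝ} {ε ε' : ℝˣ} {B B' C C' : ℝ}
    (h : affineAut s A ε B C = affineAut s' A' ε' B' C') :
    (s : ℝ) = s' ∧ A = A' ∧ (ε : ℝ) = ε' ∧ B = B' ∧ C = C' := by
  have h0 : ∀ x, affineAut s A ε B C x = affineAut s' A' ε' B' C' x := fun x => by rw [h]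
  have h1 := congrArg (fun y => (y.1 : ℂ)) (h0 (UpperHalfPlane.I, 0))
  have h2 := congrArg Prod.snd (h0 (UpperHalfPlane.I, 0))
  have h3 := congrArg Prod.snd (h0 (UpperHalfPlane.I, 1))
  simp [affineAut, Complex.ext_iff] at h1 h2 h3
  obtain ⟨hC, hB⟩ := h2
  refine ⟨h1.2, h1.1, ?_, hB, hC⟩
  linarith [h3.1]

theorem affineAut_one : affineAut ⟨1, one_pos⟩ 0 1 0 0 = 1 := by
  ext x <;> simp [affineAut]

theorem contMDiff_affineAut_symm (s : {x : ℝ // 0 < x}) (A : ℝ) (ε : ℝˣ) (B C : ℝ) :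
    ContMDiff (𝓘(ℂ).prod 𝓘(ℂ)) (𝓘(ℂ).prod 𝓘(ℂ)) ω (affineAut s A ε B C).symm := by
  have hs : (s : ℝ) ≠ 0 := s.2.ne'
  have h : affineAut s A ε B C * affineAut s⁻¹ (-((s : ℝ)⁻¹ * A)) ε⁻¹
      (-((ε : ℝ)⁻¹ * B * (s : ℝ)⁻¹)) (-((ε : ℝ)⁻¹ * (C - B * ((s : ℝ)⁻¹ * A)))) = 1 := by
    rw [affineAut_mul, ← affineAut_one]
    apply affineAut_congr
    · simp
    · field_simp; ring
    · simp
    · simp; field_simp; simp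
    · simp; ring
  have h' : (affineAut s A ε B C).symm = _ := inv_eq_of_mul_eq_one_right h
  rw [h']
  exact contMDiff_affineAut _ _ _ _ _

/-- The element `(w, z) ↦ (w + A, z + B w + C)` of the Heisenberg group acting on `ℍ × ℂ`. -/
noncomputable def heisenbergAut (A B C : ℝ) : (UpperHalfPlane × ℂ) ≃ₜ (UpperHalfPlane × ℂ) :=
  affineAut ⟨1, one_pos⟩ A 1 B C

theorem heisenbergAut_mul (A A' B B' C C' : ℝ) :
    heisenbergAut A B C * heisenbergAut A' B' C' =
      heisenbergAut (A + A') (B + B') (C + C' + B * A') := by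
  simp only [heisenbergAut, affineAut_mul]
  apply affineAut_congr <;> simp <;> ring

theorem heisenbergAut_zpow (A B C : ℝ) (m : ℤ) :
    heisenbergAut A B C ^ m =
      heisenbergAut (m * A) (m * B) (m * C + 1 / 2 * m * (m - 1) * A * B) := by
  have h := eq_zpow_mul_of_mul_eq_succ (x := heisenbergAut A B C)
    (f := fun m : ℤ => heisenbergAut (m * A) (m * B) (m * C + 1 / 2 * m * (m - 1) * A * B))
    (fun m => by
      rw [heisenbergAut_mul]
      apply affineAut_congr <;> simp <;> ring) m
  have h0 : heisenbergAut 0 0 0 = 1 := affineAut_one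
  simpa [h0] using h.symm

/-! ### The degree of a deck transformation and the eigenvectors of `N` -/

namespace InoueSMinusData

variable (D : InoueSMinusData)

theorem eq_of_α_zpow_eq {n n' : ℤ} (h : D.α ^ n = D.α ^ n') : n = n' :=
  zpow_right_injective₀ D.α_pos D.one_lt_α.ne' h

/-- The homomorphism from the deck group to `ℤ` given by the exponent of `g₀`. -/
theorem exists_degree : ∃ χ : D.group →* Multiplicative ℤ, ∀ x : D.group, ∃ m₀ m₁ k,
    (x : (UpperHalfPlane × ℂ) ≃ₜ (UpperHalfPlane × ℂ)) = D.normalForm (χ x).toAdd m₀ m₁ k := by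
  choose n m₀ m₁ k h using fun x : D.group => D.exists_normalForm x.2
  have him : ∀ (x : D.group) y, (x.1 y).1.im = D.α ^ n x * y.1.im := by
    intro x y
    rw [h x, normalForm_im]
  refine ⟨MonoidHom.mk' (fun x => Multiplicative.ofAdd (n x)) fun x y => ?_,
    fun x => ⟨_, _, _, h x⟩⟩
  rw [← ofAdd_add]
  congr 1
  apply D.eq_of_α_zpow_eq
  have h1 := him (x * y) (UpperHalfPlane.I, 0)
  have h2 : ((x * y).1 (UpperHalfPlane.I, 0)).1.im = _ := him x (y.1 (UpperHalfPlane.I, 0))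
  rw [h1, him y] at h2
  rw [zpow_add₀ D.α_pos.ne']
  simpa using h2

/-- `N` multiplies the determinant of two eigenvectors by `det N = -1` and by the product of their
eigenvalues, so eigenvectors whose eigenvalues have the same sign are proportional. -/
theorem det_eq_zero_of_eigenvectors {u v : Fin 2 → ℝ} {κ κ' : ℝ} (hκ : 0 < κ * κ')
    (hu : ∀ i, D.N.val i 0 * u 0 + D.N.val i 1 * u 1 = κ * u i)
    (hv : ∀ i, D.N.val i 0 * v 0 + D.N.val i 1 * v 1 = κ' * v i) :
    u 0 * v 1 - u 1 * v 0 = 0 := by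
  have hd : (D.N.val 0 0 * D.N.val 1 1 - D.N.val 0 1 * D.N.val 1 0 : ℝ) = -1 := by
    exact_mod_cast D.det_eq
  have : (1 + κ * κ') * (u 0 * v 1 - u 1 * v 0) = 0 := by
    have h : (κ * u 0) * (κ' * v 1) - (κ * u 1) * (κ' * v 0) =
        (-1) * (u 0 * v 1 - u 1 * v 0) := by
      rw [← hu, ← hu, ← hv, ← hv, ← hd]; ring
    linear_combination h
  exact (mul_eq_zero.mp this).resolve_left (by positivity)

theorem exists_eq_smul {u v : Fin 2 → ℝ} (hu : u ≠ 0) (h : u 0 * v 1 - u 1 * v 0 = 0) :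
    ∃ t : ℝ, v = t • u := by
  obtain ⟨i, hi⟩ := Function.ne_iff.mp hu
  have hi' : u i ≠ 0 := hi
  refine ⟨v i / u i, funext fun j => ?_⟩
  simp only [Pi.smul_apply, smul_eq_mul]
  field_simp
  fin_cases i <;> fin_cases j <;> simp <;> linarith

/-- The trace of `N` is `α - 1 / α`. -/
theorem trace_pos : 0 < D.N.val 0 0 + D.N.val 1 1 := by
  have hd : (D.N.val 0 0 * D.N.val 1 1 - D.N.val 0 1 * D.N.val 1 0 : ℝ) = -1 := by
    exact_mod_cast D.det_eq
  have hα := D.α_pos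
  have h1 := D.one_lt_α
  have ha := D.eq_a
  -- The Cayley-Hamilton theorem applied to the eigenvector `a`.
  have key : ∀ i, ((D.N.val 0 0 + D.N.val 1 1 : ℝ) * D.α - (D.α ^ 2 - 1)) * D.a i = 0 := by
    intro i
    fin_cases i
    · simp only [Fin.zero_eta]
      linear_combination (-(D.N.val 1 1 : ℝ) + D.α) * ha 0 + (D.N.val 0 1 : ℝ) * ha 1 + D.a 0 * hd
    · simp only [Fin.mk_one]
      linear_combination (-(D.N.val 0 0 : ℝ) + D.α) * ha 1 + (D.N.val 1 0 : ℝ) * ha 0 + D.a 1 * hd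
  obtain ⟨i, hi⟩ := Function.ne_iff.mp D.a_ne_zero
  have h2 := (mul_eq_zero.mp (key i)).resolve_right hi
  have h3 : (0 : ℝ) < D.N.val 0 0 + D.N.val 1 1 := by
    by_contra! h
    nlinarith
  exact_mod_cast h3

/-- `N - 1` and `N + 1` are injective, because their determinants `∓ tr N` are nonzero. The
coefficients are integers for the degrees of deck transformations and reals for `c₁`, `c₂`. -/
theorem eq_zero_of_fixed {R : Type*} [CommRing R] [IsDomain R] [CharZero R] {σ : R} (hσ : σ ^ 2 = 1)
    {v : Fin 2 → R}
    (hv : ∀ i, D.N.val i 0 * v 0 + D.N.val i 1 * v 1 = σ * v i) (i : Fin 2) : v i = 0 := by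
  have hd : (D.N.val 0 0 * D.N.val 1 1 - D.N.val 0 1 * D.N.val 1 0 : R) = -1 := by
    exact_mod_cast D.det_eq
  have ht : (D.N.val 0 0 + D.N.val 1 1 : R) ≠ 0 := by exact_mod_cast D.trace_pos.ne'
  have hσ0 : σ ≠ 0 := by rintro rfl; simp at hσ
  refine (mul_eq_zero.mp (?_ : (σ * (D.N.val 0 0 + D.N.val 1 1 : R)) * v i = 0)).resolve_left
    (mul_ne_zero hσ0 ht)
  fin_cases i
  · simp only [Fin.zero_eta]
    linear_combination (-(D.N.val 1 1 : R) + σ) * hv 0 + (D.N.val 0 1 : R) * hv 1 + v 0 * hd +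
      v 0 * hσ
  · simp only [Fin.mk_one]
    linear_combination (-(D.N.val 0 0 : R) + σ) * hv 1 + (D.N.val 1 0 : R) * hv 0 + v 1 * hd +
      v 1 * hσ

/-- If a biholomorphic map `Φ` conjugates the images of the generators of `D` under an isomorphism
`φ` onto the generators of `D''`, then it conjugates the whole deck group of `D'` onto that of
`D''`, because `φ` is surjective. -/
theorem conjugate_of_hom {D D' D'' : InoueSMinusData} (φ : D.group ≃* D'.group)
    {Φ : (UpperHalfPlane × ℂ) ≃ₜ (UpperHalfPlane × ℂ)}
    (h1 : ContMDiff (𝓘(ℂ).prod 𝓘(ℂ)) (𝓘(ℂ).prod 𝓘(ℂ)) ω Φ)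
    (h2 : ContMDiff (𝓘(ℂ).prod 𝓘(ℂ)) (𝓘(ℂ).prod 𝓘(ℂ)) ω Φ.symm)
    (h₀ : Φ * (φ ⟨D.g₀, D.g₀_mem⟩).1 = D''.g₀ * Φ)
    (h : ∀ i, Φ * (φ ⟨D.g i, D.g_mem i⟩).1 = D''.g i * Φ)
    (h₃ : Φ * (φ ⟨D.g₃, D.g₃_mem⟩).1 = D''.g₃ * Φ) : Conjugate D' D'' := by
  refine ⟨Φ, h1, h2, ?_⟩
  let ψ : D.group →* ((UpperHalfPlane × ℂ) ≃ₜ (UpperHalfPlane × ℂ)) :=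
    (MulAut.conj Φ).toMonoidHom.comp (D'.group.subtype.comp φ.toMonoidHom)
  have hψ : ∀ x y, Φ * (φ x).1 = y * Φ → ψ x = y := fun x y hxy => mul_inv_eq_of_eq_mul hxy
  have hrange : ψ.range = D'.group.map (MulAut.conj Φ).toMonoidHom := by
    rw [MonoidHom.range_comp, MonoidHom.range_comp,
      MonoidHom.range_eq_top.2 φ.surjective, ← MonoidHom.range_eq_map, Subgroup.range_subtype]
  rw [← hrange]
  apply le_antisymm
  · have htop : (⊤ : Subgroup D.group) =
        Subgroup.closure (Subtype.val ⁻¹' {D.g₀, D.g 0, D.g 1, D.g₃}) :=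
      (Subgroup.closure_closure_coe_preimage ..).symm
    rw [MonoidHom.range_eq_map, htop, MonoidHom.map_closure, Subgroup.closure_le]
    rintro _ ⟨⟨x, hx'⟩, hx, rfl⟩
    obtain rfl | rfl | rfl | rfl : x = D.g₀ ∨ x = D.g 0 ∨ x = D.g 1 ∨ x = D.g₃ := hx
    · exact (hψ _ _ h₀).symm ▸ D''.g₀_mem
    · exact (hψ _ _ (h 0)).symm ▸ D''.g_mem 0
    · exact (hψ _ _ (h 1)).symm ▸ D''.g_mem 1
    · exact (hψ _ _ h₃).symm ▸ D''.g₃_mem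
  · refine (Subgroup.closure_le _).2 ?_
    rintro _ (rfl | rfl | rfl | rfl)
    · exact ⟨_, hψ _ _ h₀⟩
    · exact ⟨_, hψ _ _ (h 0)⟩
    · exact ⟨_, hψ _ _ (h 1)⟩
    · exact ⟨_, hψ _ _ h₃⟩

end InoueSMinusData

/-! ### Normal form of a group isomorphic to the deck group -/

namespace InoueSMinusData

variable (D : InoueSMinusData)

/-- Let affine automorphisms satisfy the relations between `g₀`, `g₁`, `g₂`, `g₃` for `D`, the last
one not being the identity. Then an affine change of coordinates turns them into the standard
generators of an Inoue surface with the same integers `N`, `p`, `q`, `r`: the translation vectors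
are forced to be eigenvectors of `N`, and `c₁`, `c₂` to solve the equation that defines them. -/
theorem exists_data_of_relations {s : {x : ℝ // 0 < x}} {ε : ℝˣ} {A₀ B₀ C₀ A₃ B₃ C₃ : ℝ}
    {A B C : Fin 2 → ℝ} (hε : ε = 1 ∨ ε = -1) (hne : heisenbergAut A₃ B₃ C₃ ≠ 1)
    (R₃ : heisenbergAut A₃ B₃ C₃ * affineAut s A₀ ε B₀ C₀ * heisenbergAut A₃ B₃ C₃ =
      affineAut s A₀ ε B₀ C₀)
    (R : heisenbergAut (A 1) (B 1) (C 1) * heisenbergAut (A 0) (B 0) (C 0) *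
        heisenbergAut A₃ B₃ C₃ ^ D.r =
      heisenbergAut (A 0) (B 0) (C 0) * heisenbergAut (A 1) (B 1) (C 1))
    (R₀ : ∀ i, affineAut s A₀ ε B₀ C₀ * heisenbergAut (A i) (B i) (C i) =
      heisenbergAut (A 0) (B 0) (C 0) ^ D.N.val i 0 *
        heisenbergAut (A 1) (B 1) (C 1) ^ D.N.val i 1 *
        heisenbergAut A₃ B₃ C₃ ^ (![D.p, D.q] i) * affineAut s A₀ ε B₀ C₀) :
    ∃ (D' : InoueSMinusData) (Φ : (UpperHalfPlane × ℂ) ≃ₜ (UpperHalfPlane × ℂ)),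
      (D'.N = D.N ∧ D'.p = D.p ∧ D'.q = D.q ∧ D'.r = D.r) ∧
      ContMDiff (𝓘(ℂ).prod 𝓘(ℂ)) (𝓘(ℂ).prod 𝓘(ℂ)) ω Φ ∧
      ContMDiff (𝓘(ℂ).prod 𝓘(ℂ)) (𝓘(ℂ).prod 𝓘(ℂ)) ω Φ.symm ∧
      Φ * affineAut s A₀ ε B₀ C₀ = D'.g₀ * Φ ∧
      (∀ i, Φ * heisenbergAut (A i) (B i) (C i) = D'.g i * Φ) ∧
      Φ * heisenbergAut A₃ B₃ C₃ = D'.g₃ * Φ := by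
  obtain ⟨s, hs⟩ := s
  have hr := D.r_ne
  -- The relation between `g₀` and `g₃`.
  obtain ⟨-, h1, -, h2, h3⟩ := affineAut_injective (by
    simpa only [heisenbergAut, affineAut_mul] using R₃)
  simp at h1 h2 h3
  obtain rfl : A₃ = 0 := by
    have : (s + 1) * A₃ = 0 := by linarith
    exact (mul_eq_zero.mp this).resolve_left (by positivity)
  -- The relation between `g₁`, `g₂` and `g₃`.
  simp only [heisenbergAut_zpow, heisenbergAut_mul] at R
  obtain ⟨-, -, -, h4, h5⟩ := affineAut_injective R
  obtain rfl : B₃ = 0 := by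
    have : D.r * B₃ = 0 := by linarith
    exact (mul_eq_zero.mp this).resolve_left hr
  have hC₃ : C₃ ≠ 0 := by
    rintro rfl
    exact hne affineAut_one
  have hε' : ε = -1 := by
    refine hε.resolve_left ?_
    rintro rfl
    simp at h3
    exact hC₃ (by linarith)
  subst hε'
  simp at h5
  have hdet : A 0 * B 1 - A 1 * B 0 = -(D.r * C₃) := by linarith
  have hdet0 : A 0 * B 1 - A 1 * B 0 ≠ 0 := hdet ▸ neg_ne_zero.2 (mul_ne_zero hr hC₃)
  -- The relations between `g₀` and `g₁`, `g₂`: the vectors `A` and `B` are eigenvectors of `N`.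
  have key : ∀ i, (D.N.val i 0 * A 0 + D.N.val i 1 * A 1 = s * A i) ∧
      (D.N.val i 0 * B 0 + D.N.val i 1 * B 1 = (-1 / s) * B i) ∧
      -C i + B₀ * A i = D.N.val i 0 * C 0 + 1 / 2 * D.N.val i 0 * (D.N.val i 0 - 1) * A 0 * B 0 +
        (D.N.val i 1 * C 1 + 1 / 2 * D.N.val i 1 * (D.N.val i 1 - 1) * A 1 * B 1) +
        D.N.val i 0 * B 0 * (D.N.val i 1 * A 1) + (![D.p, D.q] i : ℤ) * C₃ +
        (D.N.val i 0 * B 0 + D.N.val i 1 * B 1) * A₀ := by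
    intro i
    have := R₀ i
    simp only [heisenbergAut_zpow, heisenbergAut_mul] at this
    obtain ⟨-, h1, -, h2, h3⟩ := affineAut_injective (by
      simpa only [heisenbergAut, affineAut_mul] using this)
    simp at h1 h2 h3
    refine ⟨by linarith, ?_, by linear_combination h3⟩
    field_simp
    linear_combination -h2
  have hA : A ≠ 0 := by rintro rfl; simp at hdet0
  have hB : B ≠ 0 := by rintro rfl; simp at hdet0
  have hsα : s = D.α := by
    have hd := D.det_eq_zero_of_eigenvectors (mul_pos D.α_pos hs) D.eq_a fun i => (key i).1
    obtain ⟨t, rfl⟩ := exists_eq_smul D.a_ne_zero hd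
    obtain ⟨i, hi⟩ := Function.ne_iff.mp hA
    have h := (key i).1
    have ha := D.eq_a i
    simp only [Pi.smul_apply, smul_eq_mul] at h hi
    refine mul_right_cancel₀ hi ?_
    linear_combination -h + t * ha
  subst hsα
  have h1s := D.one_lt_α
  let D' : InoueSMinusData :=
    { D with
      a := A
      b := B
      a_ne_zero := hA
      b_ne_zero := hB
      mulVec_a := by
        ext i
        simpa [Matrix.mulVec, dotProduct, Fin.sum_univ_two] using (key i).1
      mulVec_b := by
        ext i
        simpa [Matrix.mulVec, dotProduct, Fin.sum_univ_two] using (key i).2.1 }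
  -- `w ↦ w + u` and `z ↦ z + β w + γ` put `g₀` into the form `(w, z) ↦ (α w, -z)`.
  let u := A₀ / (D.α - 1)
  let β := -B₀ / (D.α + 1)
  let γ := -(C₀ + β * A₀) / 2
  have hα1 : D.α - 1 ≠ 0 := by linarith
  have hα2 : D.α + 1 ≠ 0 := by linarith
  have hα0 : D.α ≠ 0 := hs.ne'
  have hu : u * (D.α - 1) = A₀ := by simp only [u]; field_simp
  have hβ : β * (D.α + 1) = -B₀ := by simp only [β]; field_simp
  have hθ : D'.θ / D'.r = -C₃ := by
    have hr' : (D'.r : ℝ) ≠ 0 := D'.r_ne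
    rw [div_eq_iff hr']
    change A 0 * B 1 - A 1 * B 0 = -C₃ * D.r
    linarith
  -- The constant terms solve the linear equation defining `c`, which has a unique solution.
  have hc : ∀ i, D'.c i = C i + β * A i - B i * u := by
    intro i
    refine sub_eq_zero.mp (D'.eq_zero_of_fixed (σ := (-1 : ℝ)) (by norm_num)
      (v := fun i => D'.c i - (C i + β * A i - B i * u)) (fun i => ?_) i)
    have hc := D'.eq_c i
    obtain ⟨k1, k2, k3⟩ := key i
    have hi : ![(D'.p : ℝ), D'.q] i = ((![D.p, D.q] i : ℤ) : ℝ) := by fin_cases i <;> rfl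
    rw [hθ, hi] at hc
    simp only [e] at hc
    change (D.N.val i 0 : ℝ) * _ + D.N.val i 1 * _ = _
    change (D.N.val i 0 : ℝ) * _ + D.N.val i 1 * _ + _ +
      (1 / 2 * (D.N.val i 0 : ℝ) * (D.N.val i 0 - 1) * A 0 * B 0 +
        1 / 2 * (D.N.val i 1 : ℝ) * (D.N.val i 1 - 1) * A 1 * B 1 +
        D.N.val i 0 * D.N.val i 1 * B 0 * A 1) - _ = _ at hc
    have hu' : u * (1 - 1 / D.α) = A₀ / D.α := by rw [← hu]; field_simp
    linear_combination hc + k3 - β * k1 + (u + A₀) * k2 - A i * hβ + B i * hu'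
  refine ⟨D', affineAut ⟨1, one_pos⟩ u 1 β γ, ⟨rfl, rfl, rfl, rfl⟩, contMDiff_affineAut _ _ _ _ _,
    contMDiff_affineAut_symm _ _ _ _ _, ?_, fun i => ?_, ?_⟩
  · simp only [g₀, affineAut_mul]
    apply affineAut_congr
    · simp [D']
    · simp [D']; linear_combination -hu
    · simp
    · simp; linear_combination hβ
    · simp [γ]; ring
  · simp only [heisenbergAut, g, affineAut_mul]
    apply affineAut_congr
    · simp
    · simp [D']; ring
    · simp
    · simp [D']; ring
    · simp [hc, D']; ring
  · simp only [heisenbergAut, g₃, affineAut_mul]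
    apply affineAut_congr <;> simp [hθ]
    ring

theorem normalForm_zero (m₀ m₁ k : ℤ) : D.normalForm 0 m₀ m₁ k =
    heisenbergAut (m₀ * D.a 0 + m₁ * D.a 1) (m₀ * D.b 0 + m₁ * D.b 1) (D.const m₀ m₁ k) := by
  apply affineAut_congr <;> simp

/-- An isomorphism of deck groups transports the integers `N`, `p`, `q`, `r`: in suitable affine
coordinates the second deck group is given by the same integers as the first, with possibly
different eigenvectors. -/
theorem exists_conjugate_of_mulEquiv {D D' : InoueSMinusData} (φ : D.group ≃* D'.group) :
    ∃ D'' : InoueSMinusData, (D''.N = D.N ∧ D''.p = D.p ∧ D''.q = D.q ∧ D''.r = D.r) ∧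
      Conjugate D' D'' := by
  obtain ⟨χ, hχ⟩ := D'.exists_degree
  let G₀ : D.group := ⟨D.g₀, D.g₀_mem⟩
  let G : Fin 2 → D.group := fun i => ⟨D.g i, D.g_mem i⟩
  let G₃ : D.group := ⟨D.g₃, D.g₃_mem⟩
  -- The relations between the generators of `D`, transported to the deck group of `D'`.
  have R₃ : φ G₃ * φ G₀ * φ G₃ = φ G₀ := by
    rw [← map_mul, ← map_mul]
    exact congrArg φ (Subtype.ext D.g₃_mul_g₀_mul_g₃)
  have R : φ (G 1) * φ (G 0) * φ G₃ ^ D.r = φ (G 0) * φ (G 1) := by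
    simp only [← map_mul, ← map_zpow]
    exact congrArg φ (Subtype.ext D.g_one_mul_g_zero)
  have R₀ : ∀ i, φ G₀ * φ (G i) =
      φ (G 0) ^ D.N.val i 0 * φ (G 1) ^ D.N.val i 1 * φ G₃ ^ (![D.p, D.q] i) * φ G₀ := by
    intro i
    simp only [← map_mul, ← map_zpow]
    exact congrArg φ (Subtype.ext (D.g₀_mul_g i))
  -- The degree vanishes on the images of `g₁`, `g₂`, `g₃`.
  have d₃ : (χ (φ G₃)).toAdd = 0 := by
    have := congrArg (fun x => (χ x).toAdd) R₃
    simp at this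
    omega
  have d : ∀ i, (χ (φ (G i))).toAdd = 0 :=
    D.eq_zero_of_fixed (σ := (1 : ℤ)) (one_pow 2) (v := fun i => (χ (φ (G i))).toAdd) fun i => by
      have := congrArg (fun x => (χ x).toAdd) (R₀ i)
      simp [d₃] at this ⊢
      linarith
  obtain ⟨m₀, m₁, k, h₀⟩ := hχ (φ G₀)
  obtain ⟨m₀', m₁', k', h₃⟩ := hχ (φ G₃)
  rw [d₃, normalForm_zero] at h₃
  choose n₀ n₁ l h using fun i => hχ (φ (G i))
  simp only [d, normalForm_zero] at h
  have hne : (φ G₃ : (UpperHalfPlane × ℂ) ≃ₜ (UpperHalfPlane × ℂ)) ≠ 1 := by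
    intro h1
    have h2 : G₃ = 1 := φ.injective (by rw [map_one]; exact Subtype.ext h1)
    have h3 : D.g₃ = 1 := congrArg Subtype.val h2
    rw [← affineAut_one] at h3
    obtain ⟨-, -, -, -, h4⟩ := affineAut_injective h3
    exact div_ne_zero D.θ_ne_zero D.r_ne (neg_eq_zero.mp h4)
  have R₃' := congrArg Subtype.val R₃
  have R' := congrArg Subtype.val R
  have R₀' := fun i => congrArg Subtype.val (R₀ i)
  simp only [Subgroup.coe_mul, Subgroup.coe_zpow, h₀, h₃, h, normalForm] at R₃' R' R₀' hne
  obtain ⟨D'', Φ, hD, c1, c2, e₀, e, e₃⟩ := D.exists_data_of_relations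
    (by rcases Int.even_or_odd (χ (φ G₀)).toAdd with hn | hn
        · exact .inl hn.neg_one_zpow
        · exact .inr hn.neg_one_zpow) hne R₃'
    (A := fun i => n₀ i * D'.a 0 + n₁ i * D'.a 1) (B := fun i => n₀ i * D'.b 0 + n₁ i * D'.b 1)
    (C := fun i => D'.const (n₀ i) (n₁ i) (l i)) R' R₀'
  refine ⟨D'', hD, conjugate_of_hom φ c1 c2 ?_ (fun i => ?_) ?_⟩
  · rw [← e₀]; exact congrArg (Φ * ·) h₀
  · rw [← e]; exact congrArg (Φ * ·) (h i)
  · rw [← e₃]; exact congrArg (Φ * ·) h₃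

/-! ### The choice of the eigenvectors -/

/-- The eigenvalue `α` and the eigenlines of `a` and `b` depend only on `N`. -/
theorem exists_smul_of_N_eq {D D' : InoueSMinusData} (hN : D'.N = D.N) :
    D'.α = D.α ∧ (∃ t : ℝ, D'.a = t • D.a) ∧ ∃ t : ℝ, D'.b = t • D.b := by
  have ha := D'.eq_a
  have hb := D'.eq_b
  rw [hN] at ha hb
  have pa := D.α_pos
  have pa' := D'.α_pos
  obtain ⟨t, ht⟩ := exists_eq_smul D.a_ne_zero
    (D.det_eq_zero_of_eigenvectors (mul_pos pa pa') D.eq_a ha)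
  obtain ⟨t', ht'⟩ := exists_eq_smul D.b_ne_zero (D.det_eq_zero_of_eigenvectors
    (mul_pos_of_neg_of_neg (div_neg_of_neg_of_pos (by norm_num) pa)
      (div_neg_of_neg_of_pos (by norm_num) pa')) D.eq_b hb)
  refine ⟨?_, ⟨t, ht⟩, t', ht'⟩
  obtain ⟨i, hi⟩ := Function.ne_iff.mp D'.a_ne_zero
  have h1 := ha i
  have h2 := D.eq_a i
  rw [ht] at h1 hi
  simp only [Pi.smul_apply, smul_eq_mul] at h1 hi
  refine mul_right_cancel₀ hi ?_
  linear_combination -h1 + t * h2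

/-- Rescaling `w` by `t > 0` and `z` by any nonzero real number rescales `a` by `t` and `b` by an
arbitrary nonzero factor, so that only the sign of `a` can matter. -/
theorem conjugate_of_pos {D D' : InoueSMinusData}
    (h : D'.N = D.N ∧ D'.p = D.p ∧ D'.q = D.q ∧ D'.r = D.r) {t : ℝ} (ht : 0 < t)
    (ha : D'.a = t • D.a) : Conjugate D D' := by
  obtain ⟨hN, hp, hq, hr⟩ := h
  obtain ⟨hα, -, u, hb⟩ := exists_smul_of_N_eq hN
  have hu : u ≠ 0 := by
    rintro rfl
    exact D'.b_ne_zero (by simpa using hb)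
  have hθ : D'.θ / D'.r = t * u * (D.θ / D.r) := by
    simp [θ, ha, hb, hr]; ring
  have he : D'.e = (t * u) • D.e := by
    ext i
    simp [e, ha, hb, hN]; ring
  have hc : D'.c = (t * u) • D.c := by
    rw [c, c, hθ, he, hN, hp, hq, ← Matrix.mulVec_smul, smul_sub, smul_smul]
  refine conjugate_of_hom (MulEquiv.refl D.group)
    (Φ := affineAut ⟨t, ht⟩ 0 (Units.mk0 _ (mul_ne_zero ht.ne' hu)) 0 0)
    (contMDiff_affineAut _ _ _ _ _) (contMDiff_affineAut_symm _ _ _ _ _) ?_ (fun i => ?_) ?_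
  · simp only [MulEquiv.refl_apply, g₀, affineAut_mul]
    apply affineAut_congr <;> simp [hα, mul_comm]
  · simp only [MulEquiv.refl_apply, g, affineAut_mul]
    apply affineAut_congr <;> simp [ha, hb, hc]
    ring
  · simp only [MulEquiv.refl_apply, g₃, affineAut_mul]
    apply affineAut_congr <;> simp [hθ]

/-- `D'` is conjugate to a surface with the integers of `D` whose eigenvector for `α` is a positive
multiple of that of `D`. -/
def PositivelyConjugate (D D' : InoueSMinusData) : Prop :=
  ∃ D'' : InoueSMinusData, (D''.N = D.N ∧ D''.p = D.p ∧ D''.q = D.q ∧ D''.r = D.r) ∧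
    Conjugate D' D'' ∧ ∃ t : ℝ, 0 < t ∧ D''.a = t • D.a

theorem conjugate_of_positivelyConjugate_iff {D D₁ D₂ : InoueSMinusData} (φ₁ : D.group ≃* D₁.group)
    (φ₂ : D.group ≃* D₂.group) (h : PositivelyConjugate D D₁ ↔ PositivelyConjugate D D₂) :
    Conjugate D₁ D₂ := by
  have key : ∀ {D₁' D₂' : InoueSMinusData} {t₁ t₂ : ℝ},
      (D₁'.N = D.N ∧ D₁'.p = D.p ∧ D₁'.q = D.q ∧ D₁'.r = D.r) →
      (D₂'.N = D.N ∧ D₂'.p = D.p ∧ D₂'.q = D.q ∧ D₂'.r = D.r) →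
      Conjugate D₁ D₁' → Conjugate D₂ D₂' → D₁'.a = t₁ • D.a → D₂'.a = t₂ • D.a →
      0 < t₂ / t₁ → Conjugate D₁ D₂ := by
    intro D₁' D₂' t₁ t₂ e₁ e₂ c₁ c₂ h₁ h₂ ht
    have ht₁ : t₁ ≠ 0 := by rintro rfl; simp at ht
    refine c₁.trans ((conjugate_of_pos (by simp [e₁, e₂]) ht ?_).trans c₂.symm)
    rw [h₁, h₂, smul_smul, div_mul_cancel₀ _ ht₁]
  by_cases hp : PositivelyConjugate D D₁
  · obtain ⟨D₁', e₁, c₁, t₁, ht₁, h₁⟩ := hp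
    obtain ⟨D₂', e₂, c₂, t₂, ht₂, h₂⟩ := h.1 ⟨D₁', e₁, c₁, t₁, ht₁, h₁⟩
    exact key e₁ e₂ c₁ c₂ h₁ h₂ (div_pos ht₂ ht₁)
  · have hneg : ∀ {D' : InoueSMinusData}, (D.group ≃* D'.group) → ¬PositivelyConjugate D D' →
        ∃ D'' : InoueSMinusData, (D''.N = D.N ∧ D''.p = D.p ∧ D''.q = D.q ∧ D''.r = D.r) ∧
          Conjugate D' D'' ∧ ∃ t : ℝ, t < 0 ∧ D''.a = t • D.a := by
      intro D' φ hD'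
      obtain ⟨D'', e, c⟩ := exists_conjugate_of_mulEquiv φ
      obtain ⟨-, ⟨t, ht⟩, -⟩ := exists_smul_of_N_eq e.1
      refine ⟨D'', e, c, t, lt_of_le_of_ne (not_lt.1 fun h0 => hD' ⟨D'', e, c, t, h0, ht⟩) ?_, ht⟩
      rintro rfl
      exact D''.a_ne_zero (by simpa using ht)
    obtain ⟨D₁', e₁, c₁, t₁, ht₁, h₁⟩ := hneg φ₁ hp
    obtain ⟨D₂', e₂, c₂, t₂, ht₂, h₂⟩ := hneg φ₂ (h.not.1 hp)
    exact key e₁ e₂ c₁ c₂ h₁ h₂ (div_pos_of_neg_of_neg ht₂ ht₁)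

end InoueSMinusData

/-! ### The number of deformation classes -/

/-- A set divided into `n` families, each contained in a class of the relation generated by `r`,
meets at most `n` classes. -/
theorem encard_image_quot_mk_le {X : Type*} {r : X → X → Prop} {s : Set X} {n : ℕ} (κ : X → Fin n)
    (h : ∀ x ∈ s, ∀ y ∈ s, κ x = κ y → r x y) : (Quot.mk r '' s).encard ≤ n := by
  obtain ⟨t, hts, ht⟩ := Set.exists_subset_bijOn s (Quot.mk r)
  have hinj : Set.InjOn κ t := fun x hx y hy hxy =>
    ht.injOn hx hy (Quot.sound (h x (hts hx) y (hts hy) hxy))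
  rw [← ht.image_eq, ht.injOn.encard_image, ← hinj.encard_image]
  refine (Set.encard_le_encard (Set.subset_univ _)).trans ?_
  simp [Set.encard_univ]

theorem mainTheorem4 (D : InoueSMinusData) :
    (Quot.mk (fun D₁ D₂ : InoueSMinusData =>
          ComplexManifold.DeformationEquivalent D₁.surface D₂.surface) ''
        {D' : InoueSMinusData | ComplexManifold.HomotopyEquivalent D'.surface D.surface}).encard ≤ 8 ∧
      ∃ κ : InoueSMinusData → Fin 8, ∀ D₁ D₂ : InoueSMinusData,
        ComplexManifold.HomotopyEquivalent D₁.surface D.surface →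
        ComplexManifold.HomotopyEquivalent D₂.surface D.surface →
        κ D₁ = κ D₂ → ComplexManifold.DeformationEquivalent D₁.surface D₂.surface := by
  classical
  -- Two of the eight families suffice: the sign of the eigenvector `a`.
  let κ : InoueSMinusData → Fin 8 := fun D' => if D.PositivelyConjugate D' then 0 else 1
  have hκ : ∀ D₁ D₂ : InoueSMinusData,
      ComplexManifold.HomotopyEquivalent D₁.surface D.surface →
      ComplexManifold.HomotopyEquivalent D₂.surface D.surface →
      κ D₁ = κ D₂ → ComplexManifold.DeformationEquivalent D₁.surface D₂.surface := by
    intro D₁ D₂ h₁ h₂ h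
    obtain ⟨φ₁⟩ := InoueSMinusData.nonempty_mulEquiv_of_homotopyEquivalent h₁
    obtain ⟨φ₂⟩ := InoueSMinusData.nonempty_mulEquiv_of_homotopyEquivalent h₂
    refine (InoueSMinusData.conjugate_of_positivelyConjugate_iff φ₁.symm φ₂.symm
      ?_).deformationEquivalent
    by_cases hp₁ : D.PositivelyConjugate D₁ <;> by_cases hp₂ : D.PositivelyConjugate D₂ <;>
      simp [κ, hp₁, hp₂] at h ⊢
  exact ⟨encard_image_quot_mk_le κ fun D₁ h₁ D₂ h₂ => hκ D₁ D₂ h₁ h₂, κ, hκ⟩
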